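/- Let $\Omega$ and $\Omega'$ be relatively compact open subsets of complex manifolds $M$ and $M'$, with smooth strictly pseudoconvex boundaries $X_0$ and $X_0'$. Let $\phi:M\to\mathbb R$ be a smooth defining function of $\Omega$ ($\Omega=\{\phi>0\}$, $\overline\Omega=\{\phi\ge 0\}$ compact, $\phi=0$ and $d\phi\ne 0$ on $X_0$) such that $\log\frac1\phi$ is strictly plurisubharmonic on $\Omega$, and let $\phi'$ be such a function for $\Omega'$. Let $$X=\{(t,x)\in\mathbb C\times M:\ |t|^2=\phi(x)\},\qquad X'=\{(t',x')\in\mathbb C\times M':\ |t'|^2=\phi'(x')\}.$$ These are compact co-oriented contact manifolds: with $r=|t|^2-\phi$ and $J$ the complex structure, the contact form of $X$ is the restriction to $TX$ of $-\frac12\,dr\circ J$, and similarly for $X'$. The group $U(1)$ acts on them by $(t,x)\mapsto(e^{i\theta}t,x)$, and $X_0,X_0'$ are identified with $\{0\}\times X_0\subset X$, $\{0\}\times X_0'\subset X'$. Let $t_X,t_{X'}$ be the restrictions of the coordinate of $\mathbb C$ to $X$, $X'$. The sphere $\mathbb S^{2N+1}=\{(t,z)\in\mathbb C\times\mathbb C^N:\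 |t|^2+|z|^2=1\}$ carries the contact form $\operatorname{Im}(\bar t\,dt+\bar z\cdot dz)$ and the action $(t,z)\mapsto(e^{i\theta}t,z)$ of $U(1)$; $t_{\mathbb S}$ is its first coordinate. A smooth map is called contact if it pulls back the contact form of the target to a positive multiple of the contact form of the source. Let $f$ be a collar isomorphism, i.e. a $U(1)$-equivariant contact diffeomorphism from a $U(1)$-invariant open neighborhood of $X_0$ in $X$ onto an open neighborhood of $X_0'$ in $X'$, such that $f(X_0)=X_0'$ and such that at every point $t_{X'}\circ f$ is a positive multiple of $t_X$. **Theorem.** There is $N_0$ such that for every $N\ge N_0$ there exist $U(1)$-equivariant contact embeddings $U:X\to\mathbb S^{2N+1}$ and $U':X'\to\mathbb S^{2N+1}$ such that $U=U'\circ f$ in a neighborhood of $X_0$ in $X$, and $t_{\mathbb S}\circ U=h\,t_X$, $t_{\mathbb S}\circ U'=h'\,t_{X'}$ for smooth positive functions $h$ on $X$ and $h'$ on $X'$. -/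

import Mathlib

open Set Topology Manifold
open scoped ContDiff ComplexConjugate

noncomputable section

namespace CircleBall

/-! Throughout, `M` is a complex manifold modelled on a finite dimensional complex vector space `E`.
The same charts make it a real smooth manifold with model `𝓘(ℝ, E)`. The tangent space at a point
is identified with `E` through the preferred (holomorphic) chart there, so the complex structure on
tangent vectors is multiplication by `Complex.I` on `E`.

A complex domain `Ω = {φ > 0}` in `M` is given by its defining function `φ : M → ℝ`. -/

section

variable {E : Type*} [NormedAddCommGroup E] [NormedSpace ℂ E]
  {M : Type*} [TopologicalSpace M] [ChartedSpace E M]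
  {E' : Type*} [NormedAddCommGroup E'] [NormedSpace ℂ E']
  {M' : Type*} [TopologicalSpace M'] [ChartedSpace E' M']

/-- The differential at `x` of a real function on `M`, evaluated on a tangent vector. -/
def diff (u : M → ℝ) (x : M) (v : E) : ℝ :=
  mfderiv 𝓘(ℝ, E) 𝓘(ℝ, ℝ) u x v

/-- The Levi form (complex Hessian) `∑ (∂²u / ∂z_j ∂z̄_k) v_j v̄_k` of a real function, in the
holomorphic chart at `x`; it is a quarter of `D²u(v, v) + D²u(iv, iv)`. -/
def leviForm (u : M → ℝ) (x : M) (v : E) : ℝ :=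
  (iteratedFDeriv ℝ 2 (u ∘ (chartAt E x).symm) (chartAt E x x) ![v, v]
    + iteratedFDeriv ℝ 2 (u ∘ (chartAt E x).symm) (chartAt E x x)
        ![Complex.I • v, Complex.I • v]) / 4

/-- `Ω = {φ > 0}` is a relatively compact domain of `M` with smooth strictly pseudoconvex
boundary `{φ = 0}`, `φ` is a smooth defining function of it, and `log (1 / φ)` is strictly
plurisubharmonic on `Ω`. By regularity `{0 ≤ φ}` is the closure of `Ω`. -/
structure IsPseudoconvexDefining (φ : M → ℝ) : Prop where
  smooth : ContMDiff 𝓘(ℝ, E) 𝓘(ℝ, ℝ) ∞ φ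
  isCompact_nonneg : IsCompact {x | 0 ≤ φ x}
  regular : ∀ x, φ x = 0 → ∃ v : E, diff φ x v ≠ 0
  boundary_pseudoconvex : ∀ x, φ x = 0 → ∀ v : E, v ≠ 0 →
    diff φ x v = 0 → diff φ x (Complex.I • v) = 0 → 0 < leviForm (fun y => -φ y) x v
  log_plurisubharmonic : ∀ x, 0 < φ x → ∀ v : E, v ≠ 0 →
    0 < leviForm (fun y => Real.log (1 / φ y)) x v

/-- The boundary `X = {(t, x) : |t|² = φ x}` of the ball `{|t|² < φ}` in `ℂ × M`. -/
def ballBoundary (φ : M → ℝ) : Set (ℂ × M) := {p | ‖p.1‖ ^ 2 = φ p.2}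

/-- The boundary `X₀ = {φ = 0}` of `Ω`, seen as the subset `{0} × X₀` of `X`. -/
def binding (φ : M → ℝ) : Set (ℂ × M) := {p | p.1 = 0 ∧ φ p.2 = 0}

/-- The action `(t, x) ↦ (e^{iθ} t, x)` of `U(1)`. -/
def rot (c : Circle) (p : ℂ × M) : ℂ × M := ((c : ℂ) * p.1, p.2)

/-- The tangent vectors to `X` at `p`: the kernel of the differential of `|t|² - φ`. -/
def IsTangent (φ : M → ℝ) (p : ℂ × M) (v : ℂ × E) : Prop :=
  2 * (conj p.1 * v.1).re - diff φ p.2 v.2 = 0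

/-- The contact form of `X` as the boundary of a strictly pseudoconvex domain: the restriction of
`-(1/2) dr ∘ J` to the tangent vectors of `X`, where `r = |t|² - φ`. For the unit sphere this is
`Im (z̄ · dz)`, see `contactForm_sphereFn`. -/
def contactForm (φ : M → ℝ) (p : ℂ × M) (v : ℂ × E) : ℝ :=
  -(2 * (conj p.1 * (Complex.I * v.1)).re - diff φ p.2 (Complex.I • v.2)) / 2

/-- `F` is smooth on the subset `S` of `ℂ × M`. -/
def IsSmoothOn (F : ℂ × M → ℂ × M') (S : Set (ℂ × M)) : Prop :=
  ContMDiffOn (𝓘(ℝ, ℂ).prod 𝓘(ℝ, E)) (𝓘(ℝ, ℂ).prod 𝓘(ℝ, E')) ∞ F S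

/-- `L` is a derivative at `p` of the map `F` defined on `S`. When `S` is open in `X`, only the
restriction of `L` to the tangent vectors of `X` is used below, and that restriction is unique. -/
def HasDerivOn (F : ℂ × M → ℂ × M') (S : Set (ℂ × M)) (p : ℂ × M)
    (L : ℂ × E →L[ℝ] ℂ × E') : Prop :=
  HasMFDerivWithinAt (𝓘(ℝ, ℂ).prod 𝓘(ℝ, E)) (𝓘(ℝ, ℂ).prod 𝓘(ℝ, E')) F S p L

/-- On `S`, a piece of `X`, the map `F` to `X'` is contact: it pulls back the contact form of `X'`
to a positive multiple of the contact form of `X`. -/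
def IsContactOn (φ : M → ℝ) (φ' : M' → ℝ) (F : ℂ × M → ℂ × M') (S : Set (ℂ × M)) : Prop :=
  ∀ p ∈ S, ∃ L : ℂ × E →L[ℝ] ℂ × E', HasDerivOn F S p L ∧
    ∃ a : ℝ, 0 < a ∧ ∀ v : ℂ × E, IsTangent φ p v →
      contactForm φ' (F p) (L v) = a * contactForm φ p v

/-- On `S`, a piece of `X`, the map `F` is an immersion. -/
def IsImmersionOn (φ : M → ℝ) (F : ℂ × M → ℂ × M') (S : Set (ℂ × M)) : Prop :=
  ∀ p ∈ S, ∃ L : ℂ × E →L[ℝ] ℂ × E', HasDerivOn F S p L ∧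
    ∀ v : ℂ × E, IsTangent φ p v → L v = 0 → v = 0

/-- `f` is a collar isomorphism: an equivariant contact isomorphism from a `U(1)`-invariant
neighbourhood `f.source` of `X₀` in `X` onto a neighbourhood `f.target` of `X₀'` in `X'`, which
maps `X₀` onto `X₀'`, and for which `t' ∘ f` is a positive multiple of `t`. -/
structure IsCollarIso (φ : M → ℝ) (φ' : M' → ℝ) (f : PartialEquiv (ℂ × M) (ℂ × M')) : Prop where
  source_open : ∃ O : Set (ℂ × M), IsOpen O ∧ f.source = O ∩ ballBoundary φ
  target_open : ∃ O : Set (ℂ × M'), IsOpen O ∧ f.target = O ∩ ballBoundary φ'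
  binding_subset : binding φ ⊆ f.source
  image_binding : f '' binding φ = binding φ'
  rot_mem : ∀ c : Circle, ∀ p ∈ f.source, rot c p ∈ f.source
  smooth : IsSmoothOn (E := E) (E' := E') f f.source
  smooth_symm : IsSmoothOn (E := E') (E' := E) f.symm f.target
  equivariant : ∀ c : Circle, ∀ p ∈ f.source, f (rot c p) = rot c (f p)
  contact : IsContactOn (E := E) (E' := E') φ φ' f f.source
  t_pos : ∀ p ∈ f.source, ∃ r : ℝ, 0 < r ∧ (f p).1 = (r : ℂ) * p.1

end

/-- The unit sphere `𝕊^{2N+1} ⊆ ℂ × ℂ^N` is `X` for the unit ball of `ℂ^N` and this function. -/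
def sphereFn (N : ℕ) (z : EuclideanSpace ℂ (Fin N)) : ℝ := 1 - ‖z‖ ^ 2

theorem mem_ballBoundary_sphereFn {N : ℕ} (p : ℂ × EuclideanSpace ℂ (Fin N)) :
    p ∈ ballBoundary (sphereFn N) ↔ ‖p.1‖ ^ 2 + ‖p.2‖ ^ 2 = 1 := by
  simp only [ballBoundary, sphereFn, mem_ofPred_eq]
  constructor <;> intro h <;> linarith

theorem diff_sphereFn {N : ℕ} (z w : EuclideanSpace ℂ (Fin N)) :
    diff (sphereFn N) z w = -2 * (inner ℂ z w).re := by
  let _ : InnerProductSpace ℝ (EuclideanSpace ℂ (Fin N)) := InnerProductSpace.rclikeToReal ℂ _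
  have h := (hasStrictFDerivAt_norm_sq z).hasFDerivAt.const_sub 1
  unfold diff
  rw [mfderiv_eq_fderiv]
  change fderiv ℝ (fun z => 1 - ‖z‖ ^ 2) z w = _
  rw [h.fderiv]
  change -((2 : ℕ) • (inner ℝ z w : ℝ)) = _
  rw [real_inner_eq_re_inner ℂ]
  simp

/-- On the sphere the contact form is `Im (t̄ dt + z̄ · dz)`. -/
theorem contactForm_sphereFn {N : ℕ} (p v : ℂ × EuclideanSpace ℂ (Fin N)) :
    contactForm (sphereFn N) p v = (conj p.1 * v.1 + inner ℂ p.2 v.2).im := by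
  simp only [contactForm, diff_sphereFn, inner_smul_right]
  simp [Complex.mul_re, Complex.mul_im]
  ring

section

variable {E : Type*} [NormedAddCommGroup E] [NormedSpace ℂ E]
  {M : Type*} [TopologicalSpace M] [ChartedSpace E M]

/-- `U` is a `U(1)`-equivariant contact embedding of `X` in `𝕊^{2N+1}` (`X` is compact, so
embeddings are injective immersions). -/
structure IsContactEmbedding (φ : M → ℝ) {N : ℕ}
    (U : ℂ × M → ℂ × EuclideanSpace ℂ (Fin N)) : Prop where
  mapsTo : MapsTo U (ballBoundary φ) (ballBoundary (sphereFn N))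
  smooth : IsSmoothOn (E := E) (E' := EuclideanSpace ℂ (Fin N)) U (ballBoundary φ)
  injective : InjOn U (ballBoundary φ)
  immersion : IsImmersionOn (E := E) (E' := EuclideanSpace ℂ (Fin N)) φ U (ballBoundary φ)
  contact : IsContactOn (E := E) (E' := EuclideanSpace ℂ (Fin N)) φ (sphereFn N) U (ballBoundary φ)
  equivariant : ∀ c : Circle, ∀ p ∈ ballBoundary φ, U (rot c p) = rot c (U p)

/-- On `X`, the coordinate `t` of the sphere, pulled back by `U`, is the coordinate `t` of `X` times
a smooth positive function. -/
def PullsBackCoordinate (φ : M → ℝ) {N : ℕ}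
    (U : ℂ × M → ℂ × EuclideanSpace ℂ (Fin N)) : Prop :=
  ∃ h : ℂ × M → ℝ,
    ContMDiffOn (𝓘(ℝ, ℂ).prod 𝓘(ℝ, E)) 𝓘(ℝ, ℝ) ∞ h (ballBoundary φ) ∧
    ∀ p ∈ ballBoundary φ, 0 < h p ∧ (U p).1 = (h p : ℂ) * p.1

end

end CircleBall

end

/-! The contact form of `X` is `Im (t̄ dt) + ½ dφ ∘ J`. On a compact set every smooth real one-form
is a finite sum `∑ Im (w̄ᵢ dwᵢ)`, and when the functions `v` represent `½ dφ ∘ J` in this way, the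
map `(t, v) / |(t, v)|` to the sphere is contact, with conformal factor `1 / |(t, v)|²`. Real
functions contribute nothing to the sum, so enough of them can be added to `v` to make the map an
embedding.

A collar isomorphism multiplies `t` by a function `r > 0`. Evaluating the contact forms on the
rotation field shows that it multiplies the contact form by `r²`, hence also `½ dφ ∘ J`, and that
`r` is smooth. Functions `u` representing `½ dφ' ∘ J` on `X'` therefore transport to the functions
`r⁻¹ • u ∘ f`, which represent `½ dφ ∘ J` on the collar, and `(t, r⁻¹ • u ∘ f)` and `(t', u) ∘ f`
lie on the same ray, so they have the same projection to the sphere. As `∑ Im (v̄ dv)` is multiplied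
by `s²` when `v` is multiplied by a real function `s`, cut-offs `s₁`, `s₂` of `|t|²` with
`s₁² + s₂² = 1` glue these functions to functions defined on all of `X`. -/

noncomputable section

namespace CircleBall

section Primitives

variable {F : Type*} [NormedAddCommGroup F] [NormedSpace ℝ F] {H : Type*} [TopologicalSpace H]
  {I : ModelWithCorners ℝ F H} {N : Type*} [TopologicalSpace N] [ChartedSpace H N]
  {F' : Type*} [NormedAddCommGroup F'] [NormedSpace ℝ F'] {H' : Type*} [TopologicalSpace H']
  {I' : ModelWithCorners ℝ F' H'} {N' : Type*} [TopologicalSpace N'] [ChartedSpace H' N']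
  {V : Type*} [NormedAddCommGroup V] [NormedSpace ℝ V]
  {ι κ : Type*} [Fintype ι] [Fintype κ] {S A : Set N}

theorem im_conj_smul_mul (s l : ℝ) (z d : ℂ) :
    (conj (s • z) * (s • d + l • z)).im = s ^ 2 * (conj z * d).im := by
  simp only [Complex.real_smul, map_mul, Complex.conj_ofReal, Complex.mul_im, Complex.mul_re,
    Complex.add_im, Complex.add_re, Complex.ofReal_re, Complex.ofReal_im, Complex.conj_re,
    Complex.conj_im]
  ring

theorem im_conj_add_smul_half_I_mul (a b a' b' : ℝ) :
    (conj (a + b • (Complex.I / 2)) * (a' + b' • (Complex.I / 2))).im = (a * b' - b * a') / 2 := by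
  have hre (x y : ℝ) : (x + y • (Complex.I / 2)).re = x := by simp
  have him (x y : ℝ) : (x + y • (Complex.I / 2)).im = y / 2 := by simp [div_eq_mul_inv]
  rw [Complex.mul_im, Complex.conj_re, Complex.conj_im, hre, hre, him, him]
  ring

theorem hasMFDerivWithinAt_smul {p : N} {s : N → ℝ} {u : N → V} {l : F →L[ℝ] ℝ} {L : F →L[ℝ] V}
    (hs : HasMFDerivWithinAt I 𝓘(ℝ, ℝ) s S p l) (hu : HasMFDerivWithinAt I 𝓘(ℝ, V) u S p L) :
    HasMFDerivWithinAt I 𝓘(ℝ, V) (fun q => s q • u q) S p (s p • L + l.smulRight (u p)) := by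
  refine ⟨hs.1.smul hu.1, ?_⟩
  have h := HasFDerivWithinAt.smul (E := F) (F := V) hs.2 hu.2
  simpa only [writtenInExtChartAt, mfld_simps] using! h

theorem hasMFDerivWithinAt_add_smul_half_I {p : N} {x y : N → ℝ} {l L : F →L[ℝ] ℝ}
    (hx : HasMFDerivWithinAt I 𝓘(ℝ, ℝ) x S p l) (hy : HasMFDerivWithinAt I 𝓘(ℝ, ℝ) y S p L) :
    HasMFDerivWithinAt I 𝓘(ℝ, ℂ) (fun q => (x q : ℂ) + y q • (Complex.I / 2)) S p
      (Complex.ofRealCLM.comp l + L.smulRight (Complex.I / 2)) := by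
  have h := hasMFDerivWithinAt_smul (L := (0 : F →L[ℝ] ℂ)) hy
    (hasMFDerivWithinAt_const (Complex.I / 2) S p)
  rw [smul_zero, zero_add] at h
  exact (Complex.ofRealCLM.hasMFDerivAt.comp_hasMFDerivWithinAt p hx).add h

theorem contMDiffOn_smul_of_cutoff {s : N → ℝ} {u : N → V}
    (hu : ContMDiffOn I 𝓘(ℝ, V) ∞ u S) (hs : ContMDiffOn I 𝓘(ℝ, ℝ) ∞ s A)
    (hcut : ∀ p ∈ A, S ∈ 𝓝[A] p ∨ s =ᶠ[𝓝[A] p] 0) :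
    ContMDiffOn I 𝓘(ℝ, V) ∞ (fun p => s p • u p) A := by
  intro p hp
  rcases hcut p hp with hS | h0
  · exact (hs p hp).smul ((hu p (mem_of_mem_nhdsWithin hp hS)).mono_of_mem_nhdsWithin hS)
  · exact (contMDiffWithinAt_const (c := (0 : V))).congr_of_eventuallyEq_of_mem
      (h0.mono fun q hq => by simp [hq]) hp

/-- The functions `w` on `S` form a primitive of the real form `α`, given on the tangent vectors in
`T`, for the standard contact form of a complex coordinate space: `∑ Im (w̄ dw) = α`. Derivatives
within `S` need not be unique, so only some choice of them is required to satisfy the identity. -/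
structure IsPrimitiveOn (I : ModelWithCorners ℝ F H) (S : Set N) (T : N → Set F)
    (α : N → F → ℝ) (w : ι → N → ℂ) : Prop where
  contMDiffOn : ∀ i, ContMDiffOn I 𝓘(ℝ, ℂ) ∞ (w i) S
  exists_deriv : ∀ p ∈ S, ∃ L : ι → F →L[ℝ] ℂ,
    (∀ i, HasMFDerivWithinAt I 𝓘(ℝ, ℂ) (w i) S p (L i)) ∧
    ∀ v ∈ T p, ∑ i, (conj (w i p) * L i v).im = α p v

namespace IsPrimitiveOn

variable {T : N → Set F} {α β : N → F → ℝ} {w : ι → N → ℂ}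

theorem mono (hw : IsPrimitiveOn I S T α w) (hA : A ⊆ S) : IsPrimitiveOn I A T α w where
  contMDiffOn i := (hw.contMDiffOn i).mono hA
  exists_deriv p hp :=
    let ⟨L, hL, hα⟩ := hw.exists_deriv p (hA hp)
    ⟨L, fun i => (hL i).mono hA, hα⟩

theorem mono_tangent {T' : N → Set F} (hw : IsPrimitiveOn I S T α w) (hT : ∀ p ∈ S, T' p ⊆ T p) :
    IsPrimitiveOn I S T' α w where
  contMDiffOn := hw.contMDiffOn
  exists_deriv p hp :=
    let ⟨L, hL, hα⟩ := hw.exists_deriv p hp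
    ⟨L, hL, fun v hv => hα v (hT p hp hv)⟩

theorem congr (hw : IsPrimitiveOn I S T α w) (h : ∀ p ∈ S, ∀ v ∈ T p, α p v = β p v) :
    IsPrimitiveOn I S T β w where
  contMDiffOn := hw.contMDiffOn
  exists_deriv p hp :=
    let ⟨L, hL, hα⟩ := hw.exists_deriv p hp
    ⟨L, hL, fun v hv => (hα v hv).trans (h p hp v hv)⟩

theorem reindex (hw : IsPrimitiveOn I S T α w) (e : κ ≃ ι) :
    IsPrimitiveOn I S T α fun k => w (e k) where
  contMDiffOn k := hw.contMDiffOn (e k)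
  exists_deriv p hp :=
    let ⟨L, hL, hα⟩ := hw.exists_deriv p hp
    ⟨fun k => L (e k), fun k => hL (e k), fun v hv =>
      (e.sum_comp fun i => (conj (w i p) * L i v).im).trans (hα v hv)⟩

theorem sumElim {w' : κ → N → ℂ} (hw : IsPrimitiveOn I S T α w) (hw' : IsPrimitiveOn I S T β w') :
    IsPrimitiveOn I S T (fun p v => α p v + β p v) (Sum.elim w w') where
  contMDiffOn := Sum.rec hw.contMDiffOn hw'.contMDiffOn
  exists_deriv p hp := by
    obtain ⟨L, hL, hα⟩ := hw.exists_deriv p hp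
    obtain ⟨L', hL', hβ⟩ := hw'.exists_deriv p hp
    exact ⟨Sum.elim L L', Sum.rec hL hL', fun v hv => by
      simp only [Fintype.sum_sum_type, Sum.elim_inl, Sum.elim_inr, hα v hv, hβ v hv]⟩

theorem sigma {ι : κ → Type*} [∀ k, Fintype (ι k)] {α : κ → N → F → ℝ} {w : ∀ k, ι k → N → ℂ}
    (hw : ∀ k, IsPrimitiveOn I S T (α k) (w k)) :
    IsPrimitiveOn I S T (fun p v => ∑ k, α k p v) fun j : Σ k, ι k => w j.1 j.2 where
  contMDiffOn j := (hw j.1).contMDiffOn j.2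
  exists_deriv p hp := by
    choose L hL hα using fun k => (hw k).exists_deriv p hp
    exact ⟨fun j => L j.1 j.2, fun j => hL j.1 j.2, fun v hv => by
      rw [Fintype.sum_sigma]
      exact Finset.sum_congr rfl fun k _ => hα k v hv⟩

theorem ofReal {g : ι → N → ℝ} (hg : ∀ i, ContMDiffOn I 𝓘(ℝ, ℝ) ∞ (g i) S) :
    IsPrimitiveOn I S T (fun _ _ => 0) fun i p => (g i p : ℂ) where
  contMDiffOn i := Complex.ofRealCLM.contMDiff.comp_contMDiffOn (hg i)
  exists_deriv p hp := by
    have hd : ∀ i, ∃ l : F →L[ℝ] ℝ, HasMFDerivWithinAt I 𝓘(ℝ, ℝ) (g i) S p l := fun i =>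
      ⟨_, ((hg i p hp).mdifferentiableWithinAt (by simp)).hasMFDerivWithinAt⟩
    choose l hl using hd
    refine ⟨fun i => Complex.ofRealCLM.comp (l i), fun i =>
      Complex.ofRealCLM.hasMFDerivAt.comp_hasMFDerivWithinAt p (hl i), fun v _ => ?_⟩
    simp

theorem smul_of_cutoff {s : N → ℝ} (hw : IsPrimitiveOn I S T α w)
    (hs : ContMDiffOn I 𝓘(ℝ, ℝ) ∞ s A) (hcut : ∀ p ∈ A, S ∈ 𝓝[A] p ∨ s =ᶠ[𝓝[A] p] 0) :
    IsPrimitiveOn I A T (fun p v => s p ^ 2 * α p v) fun i p => s p • w i p where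
  contMDiffOn i := contMDiffOn_smul_of_cutoff (hw.contMDiffOn i) hs hcut
  exists_deriv p hp := by
    rcases hcut p hp with hS | h0
    · obtain ⟨L, hL, hα⟩ := hw.exists_deriv p (mem_of_mem_nhdsWithin hp hS)
      obtain ⟨l, hl⟩ : ∃ l : F →L[ℝ] ℝ, HasMFDerivWithinAt I 𝓘(ℝ, ℝ) s A p l :=
        ⟨_, ((hs p hp).mdifferentiableWithinAt (by simp)).hasMFDerivWithinAt⟩
      refine ⟨_, fun i => hasMFDerivWithinAt_smul hl ((hL i).mono_of_mem_nhdsWithin hS),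
        fun v hv => ?_⟩
      rw [← hα v hv, Finset.mul_sum]
      exact Finset.sum_congr rfl fun i _ => im_conj_smul_mul (s p) (l v) (w i p) (L i v)
    · refine ⟨fun _ => 0, fun i => ?_, fun v _ => by simp [h0.self_of_nhdsWithin hp]⟩
      exact (hasMFDerivWithinAt_const (0 : ℂ) A p).congr_of_eventuallyEq
        (h0.mono fun q hq => by simp [hq]) (by simp [h0.self_of_nhdsWithin hp])

theorem smul {s : N → ℝ} (hw : IsPrimitiveOn I S T α w) (hs : ContMDiffOn I 𝓘(ℝ, ℝ) ∞ s S) :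
    IsPrimitiveOn I S T (fun p v => s p ^ 2 * α p v) fun i p => s p • w i p :=
  hw.smul_of_cutoff hs fun _ _ => .inl self_mem_nhdsWithin

theorem comp {S' : Set N'} {T' : N' → Set F'} {α' : N' → F' → ℝ} {w : ι → N' → ℂ} {f : N → N'}
    (hw : IsPrimitiveOn I' S' T' α' w) (hf : ContMDiffOn I I' ∞ f S) (hS : MapsTo f S S')
    (hα : ∀ p ∈ S, ∃ L : F →L[ℝ] F', HasMFDerivWithinAt I I' f S p L ∧
      ∀ v ∈ T p, L v ∈ T' (f p) ∧ α' (f p) (L v) = α p v) :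
    IsPrimitiveOn I S T α fun i p => w i (f p) where
  contMDiffOn i := (hw.contMDiffOn i).comp hf hS
  exists_deriv p hp := by
    obtain ⟨L, hL, hT⟩ := hα p hp
    obtain ⟨K, hK, hsum⟩ := hw.exists_deriv (f p) (hS hp)
    exact ⟨fun i => (K i).comp L, fun i => (hK i).comp p hL hS, fun v hv =>
      (hsum _ (hT v hv).1).trans (hT v hv).2⟩

/-- `c dy = Im (w̄₀ dw₀) + Im (w̄₁ dw₁)` for `w₀ = c + i y / 2` and `w₁ = 1 + i c y / 2`, whose
forms are `(c dy - y dc) / 2` and `d (c y) / 2`. -/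
theorem mul_deriv {c y : N → ℝ} (hc : ContMDiffOn I 𝓘(ℝ, ℝ) ∞ c S)
    (hy : ContMDiffOn I 𝓘(ℝ, ℝ) ∞ y S)
    (hα : ∀ p ∈ S, ∃ L : F →L[ℝ] ℝ, HasMFDerivWithinAt I 𝓘(ℝ, ℝ) y S p L ∧
      ∀ v ∈ T p, c p * L v = α p v) :
    IsPrimitiveOn I S T α ![fun p => (c p : ℂ) + y p • (Complex.I / 2),
      fun p => ((1 : ℝ) : ℂ) + (c p • y p) • (Complex.I / 2)] where
  contMDiffOn i := by
    have hofReal := Complex.ofRealCLM.contMDiff (n := ∞)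
    fin_cases i
    · exact (hofReal.comp_contMDiffOn hc).add (hy.smul contMDiffOn_const)
    · exact contMDiffOn_const.add ((hc.smul hy).smul contMDiffOn_const)
  exists_deriv p hp := by
    obtain ⟨l, hl⟩ : ∃ l : F →L[ℝ] ℝ, HasMFDerivWithinAt I 𝓘(ℝ, ℝ) c S p l :=
      ⟨_, ((hc p hp).mdifferentiableWithinAt (by simp)).hasMFDerivWithinAt⟩
    obtain ⟨L, hL, hcL⟩ := hα p hp
    have hone := hasMFDerivWithinAt_const (I := I) (I' := 𝓘(ℝ, ℝ)) (1 : ℝ) S p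
    refine ⟨![Complex.ofRealCLM.comp l + L.smulRight (Complex.I / 2),
      Complex.ofRealCLM.comp 0 + (c p • L + l.smulRight (y p)).smulRight (Complex.I / 2)],
      Fin.forall_fin_two.2 ⟨hasMFDerivWithinAt_add_smul_half_I hl hL,
        hasMFDerivWithinAt_add_smul_half_I hone (hasMFDerivWithinAt_smul hl hL)⟩, fun v hv => ?_⟩
    have h₀ := im_conj_add_smul_half_I_mul (c p) (y p) (l v) (L v)
    have h₁ := im_conj_add_smul_half_I_mul 1 (c p * y p) 0 (c p * L v + l v * y p)
    rw [← hcL v hv, Fin.sum_univ_two]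
    refine (congrArg₂ (· + ·) h₀ h₁).trans ?_
    ring

end IsPrimitiveOn

end Primitives

section CompactSets

variable {F : Type*} [NormedAddCommGroup F] [NormedSpace ℝ F] [FiniteDimensional ℝ F]
  {H : Type*} [TopologicalSpace H] {I : ModelWithCorners ℝ F H}
  {N : Type*} [TopologicalSpace N] [T2Space N] [ChartedSpace H N] [IsManifold I ∞ N]
  {ι : Type*} {K : Set N}

omit [T2Space N] [IsManifold I ∞ N] in
theorem exists_smoothBumpCovering (hK : IsCompact K) :
    ∃ t : Finset N, Nonempty (SmoothBumpCovering t I N K) := by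
  let b (x : N) : SmoothBumpFunction I x := Classical.arbitrary _
  obtain ⟨t, htK, ht⟩ := hK.elim_nhds_subcover (fun x => interior {y | b x y = 1})
    fun x _ => interior_mem_nhds.2 (b x).eventuallyEq_one
  refine ⟨t, ⟨⟨Subtype.val, fun x => b x, fun x => htK x x.2, locallyFinite_of_finite _,
    fun x hx => ?_⟩⟩⟩
  obtain ⟨c, hc, hxc⟩ := mem_iUnion₂.1 (ht hx)
  exact ⟨⟨c, hc⟩, mem_interior_iff_mem_nhds.1 hxc⟩

/-- The smooth functions `g` embed `K` in a real coordinate space, in an affine hyperplane which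
avoids the origin since one of them is constant. -/
structure IsEmbeddingFamily (I : ModelWithCorners ℝ F H) (K : Set N) (g : ι → N → ℝ) : Prop where
  contMDiff : ∀ i, ContMDiff I 𝓘(ℝ, ℝ) ∞ (g i)
  exists_eq_one : ∃ i, ∀ x, g i x = 1
  injOn : InjOn (fun x i => g i x) K
  immersive : ∀ x ∈ K, ∀ v : F, (∀ i, mfderiv I 𝓘(ℝ, ℝ) (g i) x v = (0 : ℝ)) → v = 0

omit [FiniteDimensional ℝ F] [T2Space N] [IsManifold I ∞ N] in
theorem IsEmbeddingFamily.reindex {κ : Type*} {g : ι → N → ℝ} (hg : IsEmbeddingFamily I K g)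
    (e : κ ≃ ι) : IsEmbeddingFamily I K fun k => g (e k) where
  contMDiff k := hg.contMDiff (e k)
  exists_eq_one := e.symm.surjective.exists.2 <| by simpa using hg.exists_eq_one
  injOn x hx y hy hxy := hg.injOn hx hy (funext (e.surjective.forall.2 (congrFun hxy)))
  immersive x hx v hv := hg.immersive x hx v (e.surjective.forall.2 hv)

theorem exists_isEmbeddingFamily (hK : IsCompact K) :
    ∃ (n : ℕ) (g : Fin n → N → ℝ), IsEmbeddingFamily I K g := by
  obtain ⟨t, ⟨b⟩⟩ := exists_smoothBumpCovering (I := I) hK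
  let B := Module.finBasis ℝ (F × ℝ)
  let ℓ k : F × ℝ →L[ℝ] ℝ := (B.coord k).toContinuousLinearMap
  have hℓ {v w : F × ℝ} (h : ∀ k, ℓ k v = ℓ k w) : v = w := B.ext_elem h
  let e (i : t) (x : N) : F × ℝ := (b i x • extChartAt I (b.c i) x, b i x)
  have he i : ContMDiff I 𝓘(ℝ, F × ℝ) ∞ (e i) :=
    ((b i).contMDiff_smul contMDiffOn_extChartAt).prodMk_space (b i).contMDiff
  suffices IsEmbeddingFamily I K fun k : Option (t × Fin _) => fun x =>
      k.elim 1 fun k => ℓ k.2 (e k.1 x) from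
    ⟨_, _, this.reindex (Fintype.equivFin _).symm⟩
  refine ⟨Option.rec contMDiff_const fun k => (ℓ k.2).contMDiff.comp (he k.1), ⟨none, fun _ => rfl⟩,
    fun x hx y _ hxy => ?_, fun x hx v hv => ?_⟩
  · let i := b.ind x hx
    have he : e i x = e i y := hℓ fun k => congrFun hxy (some (i, k))
    obtain ⟨hchart, hb⟩ := Prod.mk.inj he
    have hbx : b i x = 1 := b.apply_ind x hx
    have hby : b i y = 1 := hb.symm.trans hbx
    rw [hbx, hby, one_smul, one_smul] at hchart
    exact (extChartAt I _).injOn (b.mem_extChartAt_source_of_eq_one hbx)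
      (b.mem_extChartAt_source_of_eq_one hby) hchart
  · let i := b.ind x hx
    have hD := ((he i).mdifferentiableAt (x := x) (by simp)).hasMFDerivAt
    set D : F →L[ℝ] F × ℝ := mfderiv I 𝓘(ℝ, F × ℝ) (e i) x
    have hDv : D v = 0 := hℓ fun k => by
      rw [map_zero, ← hv (some (i, k))]
      exact (DFunLike.congr_fun ((ℓ k).hasMFDerivAt.comp x hD).mfderiv v).symm
    have hchart : HasMFDerivAt I 𝓘(ℝ, F) (extChartAt I (b.c i)) x
        ((ContinuousLinearMap.fst ℝ F ℝ).comp D) :=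
      ((ContinuousLinearMap.fst ℝ F ℝ).hasMFDerivAt.comp x hD).congr_of_eventuallyEq
        ((b.eventuallyEq_one x hx).mono fun y hy => by simp [e, i, hy])
    refine (injective_iff_map_eq_zero _).1
      (isInvertible_mfderiv_extChartAt (b.mem_extChartAt_ind_source x hx)).injective v ?_
    rw [hchart.mfderiv]
    exact congrArg Prod.fst hDv

theorem IsPrimitiveOn.exists_of_isCompact {T : N → Set F} {α : N → F → ℝ} (hK : IsCompact K)
    (h : ∀ x ∈ K, ∃ S ∈ 𝓝 x, ∃ (n : ℕ) (w : Fin n → N → ℂ), IsPrimitiveOn I S T α w) :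
    ∃ (n : ℕ) (w : Fin n → N → ℂ), IsPrimitiveOn I K T α w := by
  have hbump : ∀ x : K, ∃ (b : SmoothBumpFunction I x.1) (n : ℕ) (w : Fin n → N → ℂ),
      IsPrimitiveOn I univ T (fun p v => b p ^ 2 * α p v) w := by
    rintro ⟨x, hx⟩
    obtain ⟨S, hS, n, w, hw⟩ := h x hx
    obtain ⟨b, -, hb⟩ :=
      (SmoothBumpFunction.nhds_basis_tsupport (I := I) x).mem_iff.1 (interior_mem_nhds.2 hS)
    refine ⟨b, n, _, hw.smul_of_cutoff b.contMDiff.contMDiffOn fun p _ => ?_⟩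
    rw [nhdsWithin_univ, ← notMem_tsupport_iff_eventuallyEq, or_comm, ← imp_iff_not_or]
    exact fun hp => mem_interior_iff_mem_nhds.1 (hb hp)
  choose b n w hw using hbump
  obtain ⟨t, ht⟩ := hK.elim_nhds_subcover' (fun x hx => Function.support (b ⟨x, hx⟩))
    fun x hx => (b ⟨x, hx⟩).support_mem_nhds
  let σ (p : N) : ℝ := ∑ x : t, b x p ^ 2
  have hσ : ∀ p ∈ K, 0 < σ p := fun p hp => by
    obtain ⟨x, hx, hpx⟩ := mem_iUnion₂.1 (ht hp)
    exact Finset.sum_pos' (fun _ _ => sq_nonneg _)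
      ⟨⟨x, hx⟩, Finset.mem_univ _, pow_two_pos_of_ne_zero hpx⟩
  have hroot : ContMDiffOn I 𝓘(ℝ, ℝ) ∞ (fun p => (√(σ p))⁻¹) K := fun p hp =>
    (((Real.contDiffAt_sqrt (hσ p hp).ne').inv (Real.sqrt_ne_zero'.2 (hσ p hp))).contMDiffAt.comp p
      (contMDiff_finsetSum fun x _ => (b x).contMDiff.pow 2 : ContMDiff I 𝓘(ℝ, ℝ) ∞ σ).contMDiffAt
      ).contMDiffWithinAt
  have hsum := ((IsPrimitiveOn.sigma fun x : t => hw x).mono (subset_univ K)).smul hroot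
  refine ⟨_, _, (hsum.congr fun p hp v _ => ?_).reindex (Fintype.equivFin _).symm⟩
  rw [← Finset.sum_mul, inv_pow, Real.sq_sqrt (hσ p hp).le, inv_mul_cancel_left₀ (hσ p hp).ne']

end CompactSets

section ComplexManifold

variable {E : Type*} [NormedAddCommGroup E] [NormedSpace ℂ E]
  {M : Type*} [TopologicalSpace M] [ChartedSpace E M] [IsManifold 𝓘(ℂ, E) ω M]

theorem isManifold_real : IsManifold 𝓘(ℝ, E) ∞ M :=
  isManifold_of_contDiffOn 𝓘(ℝ, E) ∞ M fun e e' he he' =>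
    have h : ContDiffOn ℂ ω (𝓘(ℂ, E) ∘ e.symm ≫ₕ e' ∘ 𝓘(ℂ, E).symm)
        (𝓘(ℂ, E).symm ⁻¹' (e.symm ≫ₕ e').source ∩ range 𝓘(ℂ, E)) :=
      ((contDiffGroupoid ω 𝓘(ℂ, E)).compatible he he').1
    (h.restrict_scalars ℝ).of_le le_top

theorem exists_mfderiv_chartAt_eq_restrictScalars {x₀ x : M} (hx : x ∈ (chartAt E x₀).source) :
    ∃ T : E →L[ℂ] E, mfderiv 𝓘(ℝ, E) 𝓘(ℝ, E) (chartAt E x₀) x = T.restrictScalars ℝ := by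
  have : IsManifold 𝓘(ℂ, E) 1 M := IsManifold.of_le (n := ω) le_top
  have h := (mdifferentiableAt_atlas (I := 𝓘(ℂ, E)) (chart_mem_atlas E x₀) hx).hasMFDerivAt
  let T : E →L[ℂ] E := mfderiv 𝓘(ℂ, E) 𝓘(ℂ, E) (chartAt E x₀) x
  have hT : HasFDerivWithinAt (writtenInExtChartAt 𝓘(ℂ, E) 𝓘(ℂ, E) x (chartAt E x₀)) T
      (range 𝓘(ℂ, E)) (extChartAt 𝓘(ℂ, E) x x) := h.2
  have hreal : HasMFDerivAt 𝓘(ℝ, E) 𝓘(ℝ, E) (chartAt E x₀) x (T.restrictScalars ℝ) :=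
    ⟨h.1, hT.restrictScalars ℝ⟩
  exact ⟨T, hreal.mfderiv⟩

theorem diff_eq_fderiv_chartAt {φ : M → ℝ} (hφ : ContMDiff 𝓘(ℝ, E) 𝓘(ℝ, ℝ) ∞ φ) {x₀ x : M}
    (hx : x ∈ (chartAt E x₀).source) (v : E) :
    diff φ x v = fderiv ℝ (φ ∘ (chartAt E x₀).symm) (chartAt E x₀ x)
      (mfderiv 𝓘(ℝ, E) 𝓘(ℝ, E) (chartAt E x₀) x v) := by
  have : IsManifold 𝓘(ℝ, E) ∞ M := isManifold_real
  let χ := chartAt E x₀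
  have hΦ : ContDiffOn ℝ ∞ (φ ∘ χ.symm) χ.target :=
    contMDiffOn_iff_contDiffOn.1 (hφ.comp_contMDiffOn contMDiffOn_chart_symm)
  have hΦx := ((hΦ.differentiableOn (by simp)).differentiableAt
    (χ.open_target.mem_nhds (χ.map_source hx))).hasFDerivAt
  have hφx : φ =ᶠ[𝓝 x] (φ ∘ χ.symm) ∘ χ := by
    filter_upwards [χ.open_source.mem_nhds hx] with z hz
    simp [χ.left_inv hz]
  have h := (hΦx.hasMFDerivAt.comp x
    (mdifferentiableAt_atlas (chart_mem_atlas E x₀) hx).hasMFDerivAt).congr_of_eventuallyEq hφx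
  rw [diff, h.mfderiv]
  rfl

variable [FiniteDimensional ℂ E] {φ : M → ℝ}

theorem exists_primitive_diff_I_chartAt (hφ : ContMDiff 𝓘(ℝ, E) 𝓘(ℝ, ℝ) ∞ φ) (x₀ : M) :
    ∃ (n : ℕ) (w : Fin n → M → ℂ), IsPrimitiveOn 𝓘(ℝ, E) (chartAt E x₀).source (fun _ => univ)
      (fun x v => diff φ x (Complex.I • v) / 2) w := by
  have : FiniteDimensional ℝ E := FiniteDimensional.complexToReal E
  have : IsManifold 𝓘(ℝ, E) ∞ M := isManifold_real
  let B := Module.finBasis ℝ E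
  let ℓ k : E →L[ℝ] ℝ := (B.coord k).toContinuousLinearMap
  let χ := chartAt E x₀
  have hχ : ContMDiffOn 𝓘(ℝ, E) 𝓘(ℝ, E) ∞ χ χ.source := contMDiffOn_chart
  let Φ : E → ℝ := φ ∘ χ.symm
  have hΦ : ContDiffOn ℝ ∞ Φ χ.target :=
    contMDiffOn_iff_contDiffOn.1 (hφ.comp_contMDiffOn contMDiffOn_chart_symm)
  let c k (x : M) : ℝ := fderiv ℝ Φ (χ x) (Complex.I • B k) / 2
  have hc k : ContMDiffOn 𝓘(ℝ, E) 𝓘(ℝ, ℝ) ∞ (c k) χ.source :=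
    ContMDiffOn.comp (I' := 𝓘(ℝ, E)) (g := fun z => fderiv ℝ Φ z (Complex.I • B k) / 2)
      (((hΦ.fderiv_of_isOpen χ.open_target (by simp)).clm_apply
        contDiffOn_const).div_const 2).contMDiffOn hχ χ.mapsTo
  have hw k := IsPrimitiveOn.mul_deriv (T := fun _ => univ)
    (α := fun x v => c k x * ℓ k (mfderiv 𝓘(ℝ, E) 𝓘(ℝ, E) χ x v)) (hc k)
    ((ℓ k).contMDiff.comp_contMDiffOn hχ) fun x hx =>
      ⟨_, ((ℓ k).hasMFDerivAt.comp x
        (mdifferentiableAt_atlas (chart_mem_atlas E x₀) hx).hasMFDerivAt).hasMFDerivWithinAt,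
        fun _ _ => rfl⟩
  refine ⟨_, _, ((IsPrimitiveOn.sigma hw).congr fun x hx v _ => ?_).reindex
    (Fintype.equivFin _).symm⟩
  obtain ⟨D, hD⟩ := exists_mfderiv_chartAt_eq_restrictScalars hx
  rw [diff_eq_fderiv_chartAt hφ hx, hD]
  change ∑ k, fderiv ℝ Φ (χ x) (Complex.I • B k) / 2 * B.repr (D v) k =
    fderiv ℝ Φ (χ x) (D (Complex.I • v)) / 2
  conv_rhs => rw [map_smul, ← B.sum_repr (D v), Finset.smul_sum, map_sum, Finset.sum_div]
  refine Finset.sum_congr rfl fun k _ => ?_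
  rw [smul_comm Complex.I (B.repr (D v) k), (fderiv ℝ Φ (χ x)).map_smul, smul_eq_mul]
  ring

theorem exists_primitive_diff_I [T2Space M] (hφ : ContMDiff 𝓘(ℝ, E) 𝓘(ℝ, ℝ) ∞ φ) {K : Set M}
    (hK : IsCompact K) : ∃ (n : ℕ) (w : Fin n → M → ℂ), IsPrimitiveOn 𝓘(ℝ, E) K (fun _ => univ)
      (fun x v => diff φ x (Complex.I • v) / 2) w := by
  have : FiniteDimensional ℝ E := FiniteDimensional.complexToReal E
  have : IsManifold 𝓘(ℝ, E) ∞ M := isManifold_real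
  exact IsPrimitiveOn.exists_of_isCompact hK fun x _ =>
    ⟨_, chart_source_mem_nhds E x, exists_primitive_diff_I_chartAt hφ x⟩

end ComplexManifold

section Submanifolds

variable {F : Type*} [NormedAddCommGroup F] [NormedSpace ℝ F] {H : Type*} [TopologicalSpace H]
  {I : ModelWithCorners ℝ F H} {N : Type*} [TopologicalSpace N] [ChartedSpace H N]
  {G : Type*} [NormedAddCommGroup G] [NormedSpace ℝ G]
  {Z : Type*} [NormedAddCommGroup Z] [NormedSpace ℝ Z]
  {V : Type*} [NormedAddCommGroup V] [NormedSpace ℝ V]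
  {ι κ : Type*} [Fintype ι] [Fintype κ] {S O : Set N} {T : N → Set F}

theorem eventually_mdifferentiableAt [IsManifold I ∞ N] {σ : Z → N} {z₀ : Z}
    (hσ : ContMDiffAt 𝓘(ℝ, Z) I ∞ σ z₀) : ∀ᶠ z in 𝓝 z₀, MDifferentiableAt 𝓘(ℝ, Z) I σ z := by
  have : IsManifold I 1 N := IsManifold.of_le (n := ∞) (by simp)
  filter_upwards [(contMDiffAt_iff_contMDiffAt_nhds (by simp)).1 (hσ.of_le (m := 1) (by simp))]
    with z hz using hz.mdifferentiableAt one_ne_zero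

theorem hasFDerivAt_comp_of_eventually_mem {u : N → V} {L : F →L[ℝ] V} {σ : Z → N} {z : Z}
    {D : Z →L[ℝ] F} (hu : HasMFDerivWithinAt I 𝓘(ℝ, V) u S (σ z) L)
    (hσ : HasMFDerivAt 𝓘(ℝ, Z) I σ z D) (hS : ∀ᶠ y in 𝓝 z, σ y ∈ S) :
    HasFDerivAt (fun y => u (σ y)) (L.comp D) z :=
  ((HasMFDerivWithinAt.comp (s := σ ⁻¹' S) z hu hσ.hasMFDerivWithinAt
    le_rfl).hasMFDerivAt hS).hasFDerivAt

theorem hasMFDerivAt_extChartAt_symm_comp [I.Boundaryless] {p : N} {σ : Z → F} {z : Z}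
    {L : Z →L[ℝ] F} (hσ : HasFDerivAt σ L z) (hz : σ z = extChartAt I p p) :
    HasMFDerivAt 𝓘(ℝ, Z) I (fun y => (extChartAt I p).symm (σ y)) z L := by
  have hp : (extChartAt I p).symm (σ z) = p := by rw [hz, extChartAt_to_inv]
  have htarget : ∀ᶠ y in 𝓝 z, σ y ∈ (extChartAt I p).target :=
    hσ.continuousAt.eventually (hz ▸ extChartAt_target_mem_nhds p)
  refine ⟨ContinuousAt.comp (hz ▸ continuousAt_extChartAt_symm p) hσ.continuousAt, ?_⟩
  refine (hσ.congr_of_eventuallyEq ?_).hasFDerivWithinAt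
  filter_upwards [htarget] with y hy
  change extChartAt I ((extChartAt I p).symm (σ z)) ((extChartAt I p).symm (σ y)) = σ y
  rw [hp, (extChartAt I p).right_inv hy]

theorem exists_levelSet_parametrization [CompleteSpace F] [FiniteDimensional ℝ G] {ρ : F → G}
    {a : F} {ℓ : F →L[ℝ] G} (hρ : ContDiffAt ℝ ∞ ρ a) (hℓ : HasFDerivAt ρ ℓ a) (hr : ℓ.range = ⊤) :
    ∃ (σ : ℓ.ker → F) (π : F →L[ℝ] ℓ.ker), ContDiffAt ℝ ∞ σ 0 ∧ σ 0 = a ∧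
      HasFDerivAt σ ℓ.ker.subtypeL 0 ∧ (∀ᶠ z in 𝓝 0, ρ (σ z) = ρ a) ∧
      ∀ᶠ x in 𝓝 a, ρ x = ρ a → σ (π (x - a)) = x := by
  have : CompleteSpace G := FiniteDimensional.complete ℝ G
  have hker : ℓ.ker.ClosedComplemented := ℓ.ker_closedComplemented_of_finiteDimensional_range
  have hs := hρ.hasStrictFDerivAt' hℓ (by simp)
  let D := HasStrictFDerivAt.implicitFunctionDataOfComplemented ρ ℓ hs hr hker
  let π : F →L[ℝ] ℓ.ker := D.rightDeriv
  have hπa : D.prodFun D.pt = (ρ a, 0) := Prod.ext rfl ((congrArg π (sub_self a)).trans π.map_zero)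
  have hpair : ContDiffAt ℝ ∞ (fun z : ℓ.ker => (ρ a, z)) 0 := contDiffAt_const.prodMk contDiffAt_id
  have hright : ContDiffAt ℝ ∞ D.rightFun D.pt :=
    π.contDiff.contDiffAt.comp a (contDiffAt_id.sub contDiffAt_const)
  refine ⟨D.implicitFunction (ρ a), π, ?_, ?_, ?_, ?_, ?_⟩
  · exact ContDiffAt.comp (g := D.implicitFunction.uncurry) 0
      (hπa ▸ D.contDiffAt_implicitFunction hρ hright (by simp)) hpair
  · exact (congrArg (D.implicitFunction (ρ a)) (congrArg Prod.snd hπa).symm).trans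
      D.implicitFunction_apply_image.self_of_nhds
  · exact (hs.to_implicitFunctionOfComplemented hr hker).hasFDerivAt
  · exact hpair.continuousAt.eventually (hπa ▸ D.leftFun_implicitFunction)
  · filter_upwards [D.leftFun_eq_iff_implicitFunction] with x hx h using hx.1 h

/-- `σ` is a smooth parametrization of `S` near `p`, with `π` a smooth left inverse of it, and the
tangent vectors to `S` are those in `T`: the values of the derivatives of `σ` are among them, and
at `p` there are no others. -/
structure IsLocalParametrization (I : ModelWithCorners ℝ F H) (S : Set N) (T : N → Set F)
    (σ : Z → N) (π : N → Z) (p : N) : Prop where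
  contMDiffAt : ContMDiffAt 𝓘(ℝ, Z) I ∞ σ (π p)
  contMDiffAt_leftInverse : ContMDiffAt I 𝓘(ℝ, Z) ∞ π p
  eventually_mem : ∀ᶠ z in 𝓝 (π p), σ z ∈ S
  eventually_leftInverse : ∀ᶠ q in 𝓝[S] p, σ (π q) = q
  eventually_mfderiv_mem : ∀ᶠ z in 𝓝 (π p), ∀ u : Z, mfderiv 𝓘(ℝ, Z) I σ z u ∈ T (σ z)
  exists_mfderiv_eq : ∀ v ∈ T p, ∃ u : Z, mfderiv 𝓘(ℝ, Z) I σ (π p) u = v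

/-- `S` is a smooth submanifold, whose tangent vectors at `p` are those in `T p`. -/
def IsSubmanifold (I : ModelWithCorners ℝ F H) (S : Set N) (T : N → Set F) : Prop :=
  ∀ p ∈ S, ∃ (Z : Submodule ℝ F) (σ : Z → N) (π : N → Z), IsLocalParametrization I S T σ π p

theorem isSubmanifold_levelSet [CompleteSpace F] [FiniteDimensional ℝ G] [I.Boundaryless]
    [IsManifold I ∞ N] {ρ : N → G} {c : G} (hρ : ContMDiff I 𝓘(ℝ, G) ∞ ρ)
    (hreg : ∀ p, ρ p = c → Function.Surjective (mfderiv I 𝓘(ℝ, G) ρ p)) :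
    IsSubmanifold I {p | ρ p = c} fun p => {v : F | mfderiv I 𝓘(ℝ, G) ρ p v = (0 : G)} := by
  intro p hp
  let ψ := extChartAt I p
  have hψ : ContMDiffAt I 𝓘(ℝ, F) ∞ ψ p := contMDiffAt_extChartAt
  have hψs : ContMDiffAt 𝓘(ℝ, F) I ∞ ψ.symm (ψ p) :=
    (contMDiffOn_extChartAt_symm p).contMDiffAt (extChartAt_target_mem_nhds p)
  have hψp : ψ.symm (ψ p) = p := extChartAt_to_inv p
  have hdρ q := (hρ.mdifferentiableAt (x := q) (by simp)).hasMFDerivAt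
  let ℓ : F →L[ℝ] G := mfderiv I 𝓘(ℝ, G) ρ p
  have hℓ : HasFDerivAt (ρ ∘ ψ.symm) ℓ (ψ p) :=
    (hdρ p).2.hasFDerivAt (by simp [I.range_eq_univ])
  obtain ⟨σ, π, hσ, hσ0, hσd, hρσ, hσπ⟩ := exists_levelSet_parametrization
    (contMDiffAt_iff_contDiffAt.1 (ContMDiffAt.comp (g := ρ) (ψ p) hρ.contMDiffAt hψs)) hℓ
    (LinearMap.range_eq_top.2 (hreg p hp))
  have hπ : π (ψ p - ψ p) = 0 := by rw [sub_self, map_zero]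
  have hs : ContMDiffAt 𝓘(ℝ, ℓ.ker) I ∞ (fun z => ψ.symm (σ z)) 0 :=
    ContMDiffAt.comp 0 (hσ0 ▸ hψs) hσ.contMDiffAt
  have hmem : ∀ᶠ z in 𝓝 0, ρ (ψ.symm (σ z)) = c :=
    hρσ.mono fun z hz => hz.trans ((congrArg ρ hψp).trans hp)
  refine ⟨ℓ.ker, fun z => ψ.symm (σ z), fun q => π (ψ q - ψ p),
    ⟨hπ ▸ hs, ?_, hπ ▸ hmem, ?_, ?_, ?_⟩⟩
  · exact π.contMDiff.contMDiffAt.comp p (hψ.sub contMDiffAt_const)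
  · filter_upwards [self_mem_nhdsWithin, nhdsWithin_le_nhds (hψ.continuousAt.eventually hσπ),
      nhdsWithin_le_nhds (extChartAt_source_mem_nhds (I := I) p)] with q hqS hq hqψ
    have hqψ : ψ.symm (ψ q) = q := ψ.left_inv hqψ
    rw [hq (by simp only [Function.comp_apply, hqψ, hψp]; exact hqS.trans hp.symm), hqψ]
  · rw [hπ]
    filter_upwards [eventually_mdifferentiableAt hs, eventually_eventually_nhds.2 hmem]
      with z hz hzc u
    have h := hasFDerivAt_comp_of_eventually_mem (σ := fun z => ψ.symm (σ z)) (S := univ)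
      (hdρ (ψ.symm (σ z))).hasMFDerivWithinAt hz.hasMFDerivAt (.of_forall fun _ => mem_univ _)
    exact DFunLike.congr_fun (h.unique ((hasFDerivAt_const c z).congr_of_eventuallyEq hzc)) u
  · intro v hv
    rw [hπ, (hasMFDerivAt_extChartAt_symm_comp hσd hσ0).mfderiv]
    exact ⟨⟨v, hv⟩, rfl⟩

theorem IsSubmanifold.inter_open (hS : IsSubmanifold I S T) (hO : IsOpen O) :
    IsSubmanifold I (O ∩ S) T := by
  rintro p ⟨hpO, hpS⟩
  obtain ⟨Z, σ, π, h⟩ := hS p hpS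
  have hσp : σ (π p) = p := h.eventually_leftInverse.self_of_nhdsWithin hpS
  exact ⟨Z, σ, π, { h with
    eventually_mem := (h.contMDiffAt.continuousAt.eventually
      (hO.mem_nhds (by rwa [hσp]))).and h.eventually_mem
    eventually_leftInverse :=
      h.eventually_leftInverse.filter_mono (nhdsWithin_mono p inter_subset_right) }⟩

theorem IsSubmanifold.deriv_unique (hS : IsSubmanifold I S T) {p : N} (hp : p ∈ S) {u : N → V}
    {L L' : F →L[ℝ] V} (hL : HasMFDerivWithinAt I 𝓘(ℝ, V) u S p L)
    (hL' : HasMFDerivWithinAt I 𝓘(ℝ, V) u S p L') {v : F} (hv : v ∈ T p) : L v = L' v := by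
  obtain ⟨Z, σ, π, h⟩ := hS p hp
  obtain ⟨x, rfl⟩ := h.exists_mfderiv_eq v hv
  have hσp : σ (π p) = p := h.eventually_leftInverse.self_of_nhdsWithin hp
  have hσ := (h.contMDiffAt.mdifferentiableAt (by simp)).hasMFDerivAt
  have hLσ := hasFDerivAt_comp_of_eventually_mem (hσp ▸ hL) hσ h.eventually_mem
  have hLσ' := hasFDerivAt_comp_of_eventually_mem (hσp ▸ hL') hσ h.eventually_mem
  exact DFunLike.congr_fun (hLσ.unique hLσ') x

/-- The pullback of the form `∑ Im (w̄ dw)` along the parametrization `σ`, evaluated at `z` on the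
constant vector field `u`. -/
def pullbackForm (w : ι → N → ℂ) (σ : Z → N) (u z : Z) : ℝ :=
  ∑ i, (conj (w i (σ z)) * fderiv ℝ (fun y => w i (σ y)) z u).im

theorem IsPrimitiveOn.pullbackForm_eq {α : N → F → ℝ} {w : ι → N → ℂ} (hw : IsPrimitiveOn I S T α w)
    {σ : Z → N} {z : Z} (hσ : MDifferentiableAt 𝓘(ℝ, Z) I σ z) (hS : ∀ᶠ y in 𝓝 z, σ y ∈ S)
    {u : Z} (hu : mfderiv 𝓘(ℝ, Z) I σ z u ∈ T (σ z)) :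
    pullbackForm w σ u z = α (σ z) (mfderiv 𝓘(ℝ, Z) I σ z u) := by
  obtain ⟨L, hL, hα⟩ := hw.exists_deriv _ hS.self_of_nhds
  rw [← hα _ hu]
  exact Finset.sum_congr rfl fun i _ => by
    rw [(hasFDerivAt_comp_of_eventually_mem (hL i) hσ.hasMFDerivAt hS).fderiv]; rfl

theorem IsPrimitiveOn.contDiffAt_pullbackForm {α : N → F → ℝ} {w : ι → N → ℂ}
    (hw : IsPrimitiveOn I S T α w) {σ : Z → N} {z : Z} (hσ : ContMDiffAt 𝓘(ℝ, Z) I ∞ σ z)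
    (hS : ∀ᶠ y in 𝓝 z, σ y ∈ S) (u : Z) :
    ContDiffAt ℝ ∞ (pullbackForm w σ u) z := by
  refine ContDiffAt.sum fun i _ => ?_
  have h : ContDiffAt ℝ ∞ (fun y => w i (σ y)) z :=
    contMDiffAt_iff_contDiffAt.1 ((ContMDiffWithinAt.comp (s := σ ⁻¹' S) z
      (hw.contMDiffOn i _ hS.self_of_nhds) hσ.contMDiffWithinAt
      (mapsTo_preimage σ S)).contMDiffAt hS)
  exact Complex.imCLM.contDiff.contDiffAt.comp z
    ((Complex.conjCLE.contDiff.contDiffAt.comp z h).mul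
      ((h.fderiv_right (m := ∞) (by simp)).clm_apply contDiffAt_const))

theorem IsSubmanifold.contMDiffOn_conformalFactor [IsManifold I ∞ N] (hS : IsSubmanifold I S T)
    {α : N → F → ℝ} {a : N → ℝ} {w : ι → N → ℂ} {w' : κ → N → ℂ} (hw : IsPrimitiveOn I S T α w)
    (hw' : IsPrimitiveOn I S T (fun p v => a p * α p v) w')
    (hα : ∀ p ∈ S, ∃ v ∈ T p, α p v ≠ 0) : ContMDiffOn I 𝓘(ℝ, ℝ) ∞ a S := by
  intro p hp
  obtain ⟨Z, σ, π, h⟩ := hS p hp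
  have hσp : σ (π p) = p := h.eventually_leftInverse.self_of_nhdsWithin hp
  obtain ⟨_, hvT, hv⟩ := hα p hp
  obtain ⟨u, rfl⟩ := h.exists_mfderiv_eq _ hvT
  have hnum := hw'.contDiffAt_pullbackForm h.contMDiffAt h.eventually_mem u
  have hden := hw.contDiffAt_pullbackForm h.contMDiffAt h.eventually_mem u
  have hden0 : pullbackForm w σ u (π p) ≠ 0 := by
    have hden := hw.pullbackForm_eq (h.contMDiffAt.mdifferentiableAt (by simp)) h.eventually_mem
      (u := u) (by rwa [hσp])
    rw [hσp] at hden
    exact hden.trans_ne hv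
  have hquot : ∀ᶠ z in 𝓝 (π p), a (σ z) = pullbackForm w' σ u z / pullbackForm w σ u z := by
    filter_upwards [eventually_mdifferentiableAt h.contMDiffAt,
      eventually_eventually_nhds.2 h.eventually_mem, h.eventually_mfderiv_mem,
      hden.continuousAt.eventually_ne hden0] with z hz hzS hzT hz0
    rw [eq_div_iff hz0, hw'.pullbackForm_eq hz hzS (hzT u), hw.pullbackForm_eq hz hzS (hzT u)]
  refine (ContMDiffAt.comp p (hnum.div hden hden0).contMDiffAt
    h.contMDiffAt_leftInverse).contMDiffWithinAt.congr_of_eventuallyEq_of_mem ?_ hp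
  filter_upwards [h.eventually_leftInverse, nhdsWithin_le_nhds
    (h.contMDiffAt_leftInverse.continuousAt.eventually hquot)] with q hq hqa
  rw [hq] at hqa
  exact hqa

end Submanifolds

section BallBoundary

variable {E : Type*} [NormedAddCommGroup E] [NormedSpace ℂ E]
  {M : Type*} [TopologicalSpace M] [ChartedSpace E M] {φ : M → ℝ}

/-- The model of `ℂ × M` as a real manifold. -/
abbrev totalModel (E : Type*) [NormedAddCommGroup E] [NormedSpace ℂ E] :
    ModelWithCorners ℝ (ℂ × E) (ModelProd ℂ E) :=
  𝓘(ℝ, ℂ).prod 𝓘(ℝ, E)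

/-- `{0 < φ}` is a relatively compact domain with smooth boundary `{φ = 0}` and smooth defining
function `φ`. -/
structure IsRegularDefining (φ : M → ℝ) : Prop where
  smooth : ContMDiff 𝓘(ℝ, E) 𝓘(ℝ, ℝ) ∞ φ
  isCompact_nonneg : IsCompact {x | 0 ≤ φ x}
  regular : ∀ x, φ x = 0 → ∃ v : E, diff φ x v ≠ 0

theorem IsPseudoconvexDefining.isRegularDefining (hφ : IsPseudoconvexDefining (E := E) φ) :
    IsRegularDefining (E := E) φ :=
  ⟨hφ.smooth, hφ.isCompact_nonneg, hφ.regular⟩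

/-- The form `½ dφ ∘ J`, pulled back from `M`: the part of the contact form of `X` which does not
involve the coordinate `t`. -/
def baseForm (φ : M → ℝ) (p : ℂ × M) (v : ℂ × E) : ℝ :=
  diff φ p.2 (Complex.I • v.2) / 2

theorem contactForm_eq_add_baseForm (φ : M → ℝ) (p : ℂ × M) (v : ℂ × E) :
    contactForm φ p v = (conj p.1 * v.1).im + baseForm φ p v := by
  have hI : (conj p.1 * (Complex.I * v.1)).re = -(conj p.1 * v.1).im := by
    rw [mul_left_comm, Complex.I_mul_re]
  rw [contactForm, baseForm, hI]
  ring

theorem nonneg_of_mem_ballBoundary {M : Type*} {φ : M → ℝ} {p : ℂ × M}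
    (hp : p ∈ ballBoundary φ) : 0 ≤ φ p.2 :=
  (sq_nonneg ‖p.1‖).trans_eq hp

theorem diff_zero (φ : M → ℝ) (x : M) : diff φ x (0 : E) = 0 :=
  map_zero (mfderiv 𝓘(ℝ, E) 𝓘(ℝ, ℝ) φ x)

theorem isTangent_I_mul_fst (φ : M → ℝ) (p : ℂ × M) :
    IsTangent φ p ((Complex.I * p.1, 0) : ℂ × E) := by
  rw [IsTangent, diff_zero, mul_left_comm, ← Complex.normSq_eq_conj_mul_self, Complex.I_mul_re,
    Complex.ofReal_im, neg_zero, mul_zero, sub_zero]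

theorem contactForm_I_mul_fst (φ : M → ℝ) (p : ℂ × M) :
    contactForm φ p ((Complex.I * p.1, 0) : ℂ × E) = ‖p.1‖ ^ 2 := by
  rw [contactForm_eq_add_baseForm, baseForm, smul_zero, diff_zero, mul_left_comm,
    ← Complex.normSq_eq_conj_mul_self, ← Complex.normSq_eq_norm_sq]
  simp

theorem IsRegularDefining.exists_contactForm_ne_zero (hφ : IsRegularDefining (E := E) φ)
    {p : ℂ × M} (hp : p ∈ ballBoundary φ) :
    ∃ v : ℂ × E, IsTangent φ p v ∧ contactForm φ p v ≠ 0 := by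
  by_cases ht : p.1 = 0
  · let D : E →L[ℝ] ℝ := mfderiv 𝓘(ℝ, E) 𝓘(ℝ, ℝ) φ p.2
    have hD : ∀ v : E, diff φ p.2 v = D v := fun _ => rfl
    obtain ⟨v, hv⟩ := hφ.regular p.2 (by simpa [ballBoundary, ht, eq_comm] using hp)
    rw [hD] at hv
    -- the projection of `J v` to the kernel of `dφ` along `v`
    let c := D (Complex.I • v) / D v
    have hc : c * D v = D (Complex.I • v) := div_mul_cancel₀ _ hv
    refine ⟨(0, Complex.I • v - c • v), ?_, fun h => ?_⟩
    · simp [IsTangent, hD, hc]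
    · have hI : Complex.I • (Complex.I • v - c • v) = -v - c • Complex.I • v := by
        rw [smul_sub, smul_smul, Complex.I_mul_I, neg_one_smul, smul_comm]
      have hDI : D (-v - c • Complex.I • v) = -D v - c * D (Complex.I • v) := by
        rw [map_sub, map_neg, map_smul, smul_eq_mul]
      rw [contactForm_eq_add_baseForm, baseForm, hI, hD, hDI, ← hc, mul_zero, Complex.zero_im] at h
      exact mul_ne_zero (by positivity : 1 + c ^ 2 ≠ 0) hv (by linear_combination -2 * h)
  · refine ⟨_, isTangent_I_mul_fst φ p, ?_⟩
    rw [contactForm_I_mul_fst]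
    simpa using ht

/-- The function `|t|² - φ`, whose zero set is `X`. -/
def levelFn {M : Type*} (φ : M → ℝ) (p : ℂ × M) : ℝ := ‖p.1‖ ^ 2 - φ p.2

theorem contMDiff_levelFn (hφ : ContMDiff 𝓘(ℝ, E) 𝓘(ℝ, ℝ) ∞ φ) :
    ContMDiff (totalModel E) 𝓘(ℝ, ℝ) ∞ (levelFn φ) :=
  ((contDiff_norm_sq ℝ).contMDiff.comp contMDiff_fst).sub (hφ.comp contMDiff_snd)

theorem mfderiv_levelFn_apply {p : ℂ × M} (hφ : MDifferentiableAt 𝓘(ℝ, E) 𝓘(ℝ, ℝ) φ p.2)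
    (v : ℂ × E) : mfderiv (totalModel E) 𝓘(ℝ, ℝ) (levelFn φ) p v =
      2 * (conj p.1 * v.1).re - diff φ p.2 v.2 := by
  have hnorm := (hasStrictFDerivAt_norm_sq p.1).hasFDerivAt.hasMFDerivAt.comp p
    (hasMFDerivAt_fst (I := 𝓘(ℝ, ℂ)) (I' := 𝓘(ℝ, E)) p)
  have hsnd := hφ.hasMFDerivAt.comp p (hasMFDerivAt_snd (I := 𝓘(ℝ, ℂ)) (I' := 𝓘(ℝ, E)) p)
  rw [show levelFn φ = (fun z : ℂ => ‖z‖ ^ 2) ∘ Prod.fst - φ ∘ Prod.snd from rfl,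
    (hnorm.sub hsnd).mfderiv]
  change (2 : ℕ) • (inner ℝ p.1 v.1 : ℝ) - diff φ p.2 v.2 = _
  rw [Complex.inner, nsmul_eq_mul, mul_comm v.1]
  rfl

theorem IsRegularDefining.exists_not_isTangent (hφ : IsRegularDefining (E := E) φ)
    {p : ℂ × M} (hp : p ∈ ballBoundary φ) : ∃ v : ℂ × E, ¬IsTangent φ p v := by
  by_cases ht : p.1 = 0
  · obtain ⟨v, hv⟩ := hφ.regular p.2 (by simpa [ballBoundary, ht, eq_comm] using hp)
    exact ⟨(0, v), by simpa [IsTangent] using hv⟩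
  · refine ⟨(p.1, 0), ?_⟩
    rw [IsTangent, diff_zero]
    simpa [← Complex.normSq_eq_conj_mul_self] using ht

theorem IsRegularDefining.isSubmanifold_ballBoundary [FiniteDimensional ℂ E]
    [IsManifold 𝓘(ℂ, E) ω M] (hφ : IsRegularDefining (E := E) φ) :
    IsSubmanifold (totalModel E) (ballBoundary φ) fun p => {v | IsTangent φ p v} := by
  have : IsManifold 𝓘(ℝ, E) ∞ M := isManifold_real
  have : FiniteDimensional ℝ E := FiniteDimensional.complexToReal E
  have : CompleteSpace (ℂ × E) := FiniteDimensional.complete ℝ _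
  have hd (p : ℂ × M) (v : ℂ × E) :
      mfderiv (totalModel E) 𝓘(ℝ, ℝ) (levelFn φ) p v = (0 : ℝ) ↔ IsTangent φ p v := by
    rw [mfderiv_levelFn_apply (hφ.smooth.mdifferentiableAt (by simp))]
    exact Iff.rfl
  have hS := isSubmanifold_levelSet (I := totalModel E) (c := 0) (contMDiff_levelFn hφ.smooth)
    fun p hp => by
      obtain ⟨v, hv⟩ := hφ.exists_not_isTangent (sub_eq_zero.1 hp)
      let ℓ : ℂ × E →L[ℝ] ℝ := mfderiv (totalModel E) 𝓘(ℝ, ℝ) (levelFn φ) p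
      exact LinearMap.surjective (f := ℓ.toLinearMap) fun h =>
        hv ((hd p v).1 (DFunLike.congr_fun h v))
  have hX : {p | levelFn φ p = 0} = ballBoundary φ := Set.ext fun _ => sub_eq_zero
  have hT : (fun p => {v : ℂ × E | mfderiv (totalModel E) 𝓘(ℝ, ℝ) (levelFn φ) p v = (0 : ℝ)}) =
      fun p => {v | IsTangent φ p v} := funext fun p => Set.ext (hd p)
  rwa [hX, hT] at hS

theorem isPrimitiveOn_fst {S : Set (ℂ × M)} {T : ℂ × M → Set (ℂ × E)} :
    IsPrimitiveOn (totalModel E) S T (fun p v => (conj p.1 * v.1).im)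
      fun (_ : Unit) (p : ℂ × M) => p.1 where
  contMDiffOn _ := contMDiffOn_fst
  exists_deriv _ _ := ⟨fun _ => ContinuousLinearMap.fst ℝ ℂ E, fun _ => hasMFDerivWithinAt_fst _ _,
    fun _ _ => Fintype.sum_unique _⟩

theorem IsRegularDefining.exists_primitive_baseForm [FiniteDimensional ℂ E] [T2Space M]
    [IsManifold 𝓘(ℂ, E) ω M] (hφ : IsRegularDefining (E := E) φ) :
    ∃ (n : ℕ) (w : Fin n → M → ℂ), IsPrimitiveOn (totalModel E) (ballBoundary φ) (fun _ => univ)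
      (baseForm φ) fun i p => w i p.2 := by
  obtain ⟨n, w, hw⟩ := exists_primitive_diff_I hφ.smooth hφ.isCompact_nonneg
  exact ⟨n, w, hw.comp contMDiffOn_snd (fun p hp => nonneg_of_mem_ballBoundary hp) fun p _ =>
    ⟨ContinuousLinearMap.snd ℝ ℂ E, hasMFDerivWithinAt_snd _ _, fun v _ => ⟨mem_univ _, rfl⟩⟩⟩

theorem IsPrimitiveOn.elim_fst {ι : Type*} [Fintype ι] {S : Set (ℂ × M)}
    {T : ℂ × M → Set (ℂ × E)} {w : ι → ℂ × M → ℂ}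
    (hw : IsPrimitiveOn (totalModel E) S T (baseForm φ) w) :
    IsPrimitiveOn (totalModel E) S T (contactForm φ) (Sum.elim (fun (_ : Unit) p => p.1) w) :=
  (isPrimitiveOn_fst.sumElim hw).congr fun p _ v _ => (contactForm_eq_add_baseForm φ p v).symm

end BallBoundary

section Collar

variable {E : Type*} [NormedAddCommGroup E] [NormedSpace ℂ E]
  {M : Type*} [TopologicalSpace M] [ChartedSpace E M]
  {E' : Type*} [NormedAddCommGroup E'] [NormedSpace ℂ E']
  {M' : Type*} [TopologicalSpace M'] [ChartedSpace E' M']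
  {φ : M → ℝ} {φ' : M' → ℝ}

theorem hasMFDerivAt_rot (p : ℂ × M) :
    HasMFDerivAt 𝓘(ℝ, ℝ) (totalModel E) (fun θ : ℝ => rot (Circle.exp θ) p) 0
      ((ContinuousLinearMap.toSpanSingleton ℝ (Complex.I * p.1)).prod 0) := by
  have hexp : HasDerivAt (fun θ : ℝ => (Circle.exp θ : ℂ) * p.1) (Complex.I * p.1) 0 := by
    simpa [Circle.coe_exp] using
      ((Complex.ofRealCLM.hasDerivAt (x := (0 : ℝ))).mul_const Complex.I).cexp.mul_const p.1
  exact hexp.hasFDerivAt.hasMFDerivAt.prodMk (hasMFDerivAt_const p.2 (0 : ℝ))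

theorem HasDerivOn.map_I_mul_fst {S : Set (ℂ × M)} {F : ℂ × M → ℂ × M'} {p : ℂ × M}
    {L : ℂ × E →L[ℝ] ℂ × E'} (hL : HasDerivOn F S p L) (hS : ∀ c : Circle, rot c p ∈ S)
    (hF : ∀ c : Circle, F (rot c p) = rot c (F p)) :
    L (Complex.I * p.1, 0) = (Complex.I * (F p).1, 0) := by
  have h0 : rot (Circle.exp 0) p = p := by simp [rot]
  have hFrot := HasMFDerivWithinAt.comp (f := fun θ : ℝ => rot (Circle.exp θ) p) (s := univ) 0
    (h0.symm ▸ hL) (hasMFDerivAt_rot p).hasMFDerivWithinAt fun θ _ => hS _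
  have hrotF := (hasMFDerivWithinAt_univ.1 hFrot).congr_of_eventuallyEq
    (f₁ := fun θ : ℝ => rot (Circle.exp θ) (F p)) (.of_forall fun θ => (hF _).symm)
  have hL' : L.comp ((ContinuousLinearMap.toSpanSingleton ℝ (Complex.I * p.1)).prod 0) =
      (ContinuousLinearMap.toSpanSingleton ℝ (Complex.I * (F p).1)).prod (0 : ℝ →L[ℝ] E') :=
    hasMFDerivAt_unique hrotF (hasMFDerivAt_rot (F p))
  simpa using DFunLike.congr_fun hL' 1

/-- On the invariant set `S`, the map `F` to `X'` is smooth, equivariant, and multiplies the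
coordinate `t` by the smooth positive function `r`. -/
structure IsScalingMapOn (φ' : M' → ℝ) (S : Set (ℂ × M)) (r : ℂ × M → ℝ)
    (F : ℂ × M → ℂ × M') : Prop where
  smooth : IsSmoothOn (E := E) (E' := E') F S
  smooth_factor : ContMDiffOn (totalModel E) 𝓘(ℝ, ℝ) ∞ r S
  factor_pos : ∀ p ∈ S, 0 < r p
  mapsTo : MapsTo F S (ballBoundary φ')
  fst_eq : ∀ p ∈ S, (F p).1 = r p • p.1
  rot_mem : ∀ c : Circle, ∀ p ∈ S, rot c p ∈ S
  equivariant : ∀ c : Circle, ∀ p ∈ S, F (rot c p) = rot c (F p)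

theorem IsScalingMapOn.factor_rot {S : Set (ℂ × M)} {r : ℂ × M → ℝ} {F : ℂ × M → ℂ × M'}
    (hF : IsScalingMapOn (E := E) (E' := E') φ' S r F) (c : Circle) {p : ℂ × M} (hp : p ∈ S) :
    r (rot c p) = r p := by
  by_cases h0 : p.1 = 0
  · rw [show rot c p = p by ext <;> simp [rot, h0]]
  · have h := hF.fst_eq _ (hF.rot_mem c p hp)
    rw [hF.equivariant c p hp] at h
    simp only [rot, hF.fst_eq p hp] at h
    rw [mul_smul_comm] at h
    exact (smul_left_injective ℝ (mul_ne_zero (Circle.coe_ne_zero c) h0) h).symm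

theorem norm_sq_fst_of_contactForm_eq {S : Set (ℂ × M)} {F : ℂ × M → ℂ × M'} {p : ℂ × M} {a : ℝ}
    {L : ℂ × E →L[ℝ] ℂ × E'} (hL : HasDerivOn F S p L) (hS : ∀ c : Circle, rot c p ∈ S)
    (hF : ∀ c : Circle, F (rot c p) = rot c (F p))
    (ha : ∀ v, IsTangent φ p v → contactForm φ' (F p) (L v) = a * contactForm φ p v) :
    ‖(F p).1‖ ^ 2 = a * ‖p.1‖ ^ 2 := by
  have h := ha _ (isTangent_I_mul_fst φ p)
  rwa [hL.map_I_mul_fst hS hF, contactForm_I_mul_fst, contactForm_I_mul_fst] at h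

theorem baseForm_eq_of_contactForm_eq {S : Set (ℂ × M)} {F : ℂ × M → ℂ × M'} {r : ℂ × M → ℝ}
    {p : ℂ × M} {L : ℂ × E →L[ℝ] ℂ × E'}
    (hS : IsSubmanifold (totalModel E) S fun p => {v | IsTangent φ p v}) (hp : p ∈ S)
    (hr : ContMDiffOn (totalModel E) 𝓘(ℝ, ℝ) ∞ r S) (hFr : ∀ q ∈ S, (F q).1 = r q • q.1)
    (hL : HasDerivOn F S p L) {v : ℂ × E} (hv : IsTangent φ p v)
    (hα : contactForm φ' (F p) (L v) = r p ^ 2 * contactForm φ p v) :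
    baseForm φ' (F p) (L v) = r p ^ 2 * baseForm φ p v := by
  obtain ⟨l, hl⟩ : ∃ l : ℂ × E →L[ℝ] ℝ,
      HasMFDerivWithinAt (totalModel E) 𝓘(ℝ, ℝ) r S p l :=
    ⟨_, ((hr p hp).mdifferentiableWithinAt (by simp)).hasMFDerivWithinAt⟩
  have hfst : HasMFDerivWithinAt (totalModel E) 𝓘(ℝ, ℂ) (fun q => (F q).1) S p
      ((ContinuousLinearMap.fst ℝ ℂ E').comp L) :=
    (hasMFDerivAt_fst (I := 𝓘(ℝ, ℂ)) (I' := 𝓘(ℝ, E')) (F p)).comp_hasMFDerivWithinAt p hL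
  have hsmul := (hasMFDerivWithinAt_smul (L := ContinuousLinearMap.fst ℝ ℂ E) hl
    (hasMFDerivWithinAt_fst S p)).congr_of_eventuallyEq (f₁ := fun q => (F q).1)
    (Filter.eventually_of_mem self_mem_nhdsWithin hFr) (hFr p hp)
  have hLv : (L v).1 = r p • v.1 + l v • p.1 := hS.deriv_unique hp hfst hsmul hv
  rw [contactForm_eq_add_baseForm, contactForm_eq_add_baseForm, hLv, hFr p hp] at hα
  linarith [im_conj_smul_mul (r p) (l v) p.1 v.1]

variable {f : PartialEquiv (ℂ × M) (ℂ × M')}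

theorem IsCollarIso.source_subset (hf : IsCollarIso (E := E) (E' := E') φ φ' f) :
    f.source ⊆ ballBoundary φ := by
  obtain ⟨O, -, hs⟩ := hf.source_open
  exact hs ▸ inter_subset_right

theorem IsCollarIso.target_subset (hf : IsCollarIso (E := E) (E' := E') φ φ' f) :
    f.target ⊆ ballBoundary φ' := by
  obtain ⟨O, -, hs⟩ := hf.target_open
  exact hs ▸ inter_subset_right

theorem IsCollarIso.isScalingMapOn_symm (hf : IsCollarIso (E := E) (E' := E') φ φ' f)
    {r : ℂ × M → ℝ} (hr : IsScalingMapOn (E := E) (E' := E') φ' f.source r f) :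
    IsScalingMapOn (E := E') (E' := E) φ f.target (fun q => (r (f.symm q))⁻¹) f.symm where
  smooth := hf.smooth_symm
  smooth_factor := (hr.smooth_factor.comp hf.smooth_symm f.mapsTo_symm).inv₀
    fun q hq => (hr.factor_pos _ (f.map_target hq)).ne'
  factor_pos q hq := inv_pos.2 (hr.factor_pos _ (f.map_target hq))
  mapsTo := f.mapsTo_symm.mono_right hf.source_subset
  fst_eq q hq := by
    have h := hr.fst_eq _ (f.map_target hq)
    rw [f.right_inv hq] at h
    rw [h, inv_smul_smul₀ (hr.factor_pos _ (f.map_target hq)).ne']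
  rot_mem c q hq := by
    have h := f.map_source (hf.rot_mem c _ (f.map_target hq))
    rwa [hf.equivariant c _ (f.map_target hq), f.right_inv hq] at h
  equivariant c q hq := by
    have h := hf.rot_mem c _ (f.map_target hq)
    rw [← f.left_inv h, hf.equivariant c _ (f.map_target hq), f.right_inv hq]

variable [FiniteDimensional ℂ E] [IsManifold 𝓘(ℂ, E) ω M]

theorem IsCollarIso.isSubmanifold_source (hφ : IsRegularDefining (E := E) φ)
    (hf : IsCollarIso (E := E) (E' := E') φ φ' f) :
    IsSubmanifold (totalModel E) f.source fun p => {v | IsTangent φ p v} := by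
  obtain ⟨O, hO, hs⟩ := hf.source_open
  exact hs ▸ hφ.isSubmanifold_ballBoundary.inter_open hO

variable [T2Space M] [FiniteDimensional ℂ E'] [T2Space M'] [IsManifold 𝓘(ℂ, E') ω M']

theorem IsCollarIso.contMDiffOn_of_contactForm_eq (hφ : IsRegularDefining (E := E) φ)
    (hφ' : IsRegularDefining (E := E') φ') (hf : IsCollarIso (E := E) (E' := E') φ φ' f)
    {a : ℂ × M → ℝ} (ha : ∀ p ∈ f.source, ∃ L : ℂ × E →L[ℝ] ℂ × E', HasDerivOn f f.source p L ∧
      ∀ v, IsTangent φ p v → contactForm φ' (f p) (L v) = a p * contactForm φ p v) :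
    ContMDiffOn (totalModel E) 𝓘(ℝ, ℝ) ∞ a f.source := by
  have : IsManifold 𝓘(ℝ, E) ∞ M := isManifold_real
  obtain ⟨_, w, hw⟩ := hφ.exists_primitive_baseForm
  obtain ⟨_, w', hw'⟩ := hφ'.exists_primitive_baseForm
  refine (hf.isSubmanifold_source hφ).contMDiffOn_conformalFactor (α := contactForm φ)
    ((hw.elim_fst.mono hf.source_subset).mono_tangent fun _ _ => subset_univ _)
    (hw'.elim_fst.comp hf.smooth (f.mapsTo.mono_right hf.target_subset) fun p hp => ?_)
    fun p hp => hφ.exists_contactForm_ne_zero (hf.source_subset hp)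
  obtain ⟨L, hL, hLa⟩ := ha p hp
  exact ⟨L, hL, fun v hv => ⟨mem_univ _, hLa v hv⟩⟩

/-- The value of the contact form on the rotation field is `|t|²`, so that `r²` is the conformal
factor of the contact form; it is a smooth function at `t = 0` too. -/
theorem IsCollarIso.exists_isScalingMapOn (hφ : IsRegularDefining (E := E) φ)
    (hφ' : IsRegularDefining (E := E') φ') (hf : IsCollarIso (E := E) (E' := E') φ φ' f) :
    ∃ r, IsScalingMapOn (E := E) (E' := E') φ' f.source r f ∧
      ∀ p ∈ f.source, ∃ L : ℂ × E →L[ℝ] ℂ × E', HasDerivOn f f.source p L ∧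
        ∀ v, IsTangent φ p v → baseForm φ' (f p) (L v) = r p ^ 2 * baseForm φ p v := by
  have hcontact := hf.contact
  simp only [IsContactOn] at hcontact
  choose! L hL a ha0 ha using hcontact
  have hsqrt p (hp : p ∈ f.source) : √(a p) ^ 2 = a p := Real.sq_sqrt (ha0 p hp).le
  have hfst : ∀ p ∈ f.source, (f p).1 = √(a p) • p.1 := by
    intro p hp
    obtain ⟨s, hs0, hsp⟩ := hf.t_pos p hp
    by_cases h0 : p.1 = 0
    · rw [hsp, h0, mul_zero, smul_zero]
    · have hnorm := norm_sq_fst_of_contactForm_eq (hL p hp) (fun c => hf.rot_mem c p hp)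
        (fun c => hf.equivariant c p hp) (ha p hp)
      rw [hsp, norm_mul, mul_pow, Complex.norm_real, Real.norm_eq_abs, sq_abs] at hnorm
      rw [hsp, ← mul_right_cancel₀ (pow_ne_zero 2 (norm_ne_zero_iff.2 h0)) hnorm,
        Real.sqrt_sq hs0.le, Complex.real_smul]
  have hsmooth : ContMDiffOn (totalModel E) 𝓘(ℝ, ℝ) ∞ (fun p => √(a p)) f.source := fun p hp =>
    (Real.contDiffAt_sqrt (ha0 p hp).ne').contMDiffAt.comp_contMDiffWithinAt p
      (hf.contMDiffOn_of_contactForm_eq hφ hφ' (fun p hp => ⟨L p, hL p hp, ha p hp⟩) p hp)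
  refine ⟨fun p => √(a p), ⟨hf.smooth, hsmooth, fun p hp => Real.sqrt_pos.2 (ha0 p hp),
    f.mapsTo.mono_right hf.target_subset, hfst, hf.rot_mem, hf.equivariant⟩, fun p hp =>
    ⟨L p, hL p hp, fun v hv => ?_⟩⟩
  exact baseForm_eq_of_contactForm_eq (hf.isSubmanifold_source hφ) hp hsmooth hfst (hL p hp) hv
    (by rw [hsqrt p hp, ha p hp v hv])

end Collar

section Cutoff

variable {M : Type*} {δ : ℝ} {p : ℂ × M}

/-- A cut-off function of `|t|²`, equal to `1` for `|t|² ≤ δ / 3` and to `0` for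
`2 δ / 3 ≤ |t|²`. -/
def plateau (δ : ℝ) (p : ℂ × M) : ℝ :=
  Real.cos (Real.pi / 2 * Real.smoothTransition (3 * ‖p.1‖ ^ 2 / δ - 1))

/-- The companion of `plateau`, for which `plateau ^ 2 + coplateau ^ 2 = 1`. -/
def coplateau (δ : ℝ) (p : ℂ × M) : ℝ :=
  Real.sin (Real.pi / 2 * Real.smoothTransition (3 * ‖p.1‖ ^ 2 / δ - 1))

theorem plateau_sq_add_coplateau_sq (δ : ℝ) (p : ℂ × M) :
    plateau δ p ^ 2 + coplateau δ p ^ 2 = 1 :=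
  Real.cos_sq_add_sin_sq _

theorem plateau_eq_one (hδ : 0 < δ) (h : ‖p.1‖ ^ 2 < δ / 3) : plateau δ p = 1 := by
  have h0 : 3 * ‖p.1‖ ^ 2 / δ - 1 ≤ 0 := by
    rw [sub_nonpos, div_le_one hδ]
    linarith
  rw [plateau, Real.smoothTransition.zero_of_nonpos h0, mul_zero, Real.cos_zero]

theorem coplateau_eq_zero (hδ : 0 < δ) (h : ‖p.1‖ ^ 2 < δ / 3) : coplateau δ p = 0 := by
  simpa [plateau_eq_one hδ h] using plateau_sq_add_coplateau_sq δ p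

theorem plateau_eq_zero (hδ : 0 < δ) (h : 2 * δ / 3 < ‖p.1‖ ^ 2) : plateau δ p = 0 := by
  have h1 : 1 ≤ 3 * ‖p.1‖ ^ 2 / δ - 1 := by
    rw [le_sub_iff_add_le, le_div_iff₀ hδ]
    linarith
  rw [plateau, Real.smoothTransition.one_of_one_le h1, mul_one, Real.cos_pi_div_two]

theorem norm_fst_rot (c : Circle) (p : ℂ × M) : ‖(rot c p).1‖ = ‖p.1‖ := by
  rw [rot, norm_mul, Circle.norm_coe, one_mul]

theorem plateau_rot (c : Circle) : plateau δ (rot c p) = plateau δ p := by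
  rw [plateau, norm_fst_rot, plateau]

theorem coplateau_rot (c : Circle) : coplateau δ (rot c p) = coplateau δ p := by
  rw [coplateau, norm_fst_rot, coplateau]

variable {E : Type*} [NormedAddCommGroup E] [NormedSpace ℂ E] [TopologicalSpace M]
  [ChartedSpace E M]

theorem contMDiff_smoothTransition_norm_sq_fst : ContMDiff (totalModel E) 𝓘(ℝ, ℝ) ∞
    fun p : ℂ × M => Real.pi / 2 * Real.smoothTransition (3 * ‖p.1‖ ^ 2 / δ - 1) :=
  ContMDiff.comp
    (g := fun z : ℂ => Real.pi / 2 * Real.smoothTransition (3 * ‖z‖ ^ 2 / δ - 1))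
    (contDiff_const.mul (Real.smoothTransition.contDiff.comp
      (((contDiff_const.mul (contDiff_norm_sq ℝ)).div_const δ).sub contDiff_const))).contMDiff
    contMDiff_fst

theorem contMDiff_plateau : ContMDiff (totalModel E) 𝓘(ℝ, ℝ) ∞ (plateau (M := M) δ) :=
  Real.contDiff_cos.contMDiff.comp contMDiff_smoothTransition_norm_sq_fst

theorem contMDiff_coplateau : ContMDiff (totalModel E) 𝓘(ℝ, ℝ) ∞ (coplateau (M := M) δ) :=
  Real.contDiff_sin.contMDiff.comp contMDiff_smoothTransition_norm_sq_fst

end Cutoff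

section CollarRadius

theorem IsRegularDefining.isCompact_ballBoundary {E : Type*} [NormedAddCommGroup E]
    [NormedSpace ℂ E] {M : Type*} [TopologicalSpace M] [ChartedSpace E M] {φ : M → ℝ}
    (hφ : IsRegularDefining (E := E) φ) : IsCompact (ballBoundary φ) := by
  have hcont : Continuous φ := hφ.smooth.continuous
  obtain ⟨C, hC⟩ := hφ.isCompact_nonneg.bddAbove_image hcont.continuousOn
  refine ((isCompact_closedBall (0 : ℂ) √C).prod hφ.isCompact_nonneg).of_isClosed_subset
    (isClosed_eq (by fun_prop) (by fun_prop)) fun p hp => ⟨?_, nonneg_of_mem_ballBoundary hp⟩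
  exact mem_closedBall_zero_iff.2
    (Real.le_sqrt_of_sq_le (hp.trans_le (hC ⟨p.2, nonneg_of_mem_ballBoundary hp, rfl⟩)))

variable {M : Type*} [TopologicalSpace M] {φ : M → ℝ} {S O : Set (ℂ × M)} {δ : ℝ}

/-- `S` is a neighbourhood in `X` of the collar `{|t|² < δ}` of the binding. -/
structure IsCollarRadius (φ : M → ℝ) (S : Set (ℂ × M)) (δ : ℝ) : Prop where
  pos : 0 < δ
  mem_nhdsWithin : ∀ p ∈ ballBoundary φ, ‖p.1‖ ^ 2 < δ → S ∈ 𝓝[ballBoundary φ] p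

theorem exists_isCollarRadius (hX : IsCompact (ballBoundary φ)) (hO : IsOpen O)
    (hS : S = O ∩ ballBoundary φ) (hb : binding φ ⊆ S) : ∃ δ, IsCollarRadius φ S δ := by
  suffices ∃ δ : ℝ, 0 < δ ∧ ∀ p ∈ ballBoundary φ, ‖p.1‖ ^ 2 < δ → p ∈ O by
    obtain ⟨δ, hδ, hδO⟩ := this
    exact ⟨δ, hδ, fun p hp hpδ => hS ▸ Filter.inter_mem
      (mem_nhdsWithin_of_mem_nhds (hO.mem_nhds (hδO p hp hpδ))) self_mem_nhdsWithin⟩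
  rcases (ballBoundary φ \ O).eq_empty_or_nonempty with h0 | h0
  · exact ⟨1, one_pos, fun p hp _ => sdiff_eq_empty.1 h0 hp⟩
  · obtain ⟨q, ⟨hqX, hqO⟩, hmin⟩ := (hX.diff hO).exists_isMinOn h0 (f := fun p => ‖p.1‖ ^ 2)
      (Continuous.continuousOn (by fun_prop))
    refine ⟨‖q.1‖ ^ 2, pow_pos (norm_pos_iff.2 fun hq => hqO ?_) 2, fun p hp hlt => ?_⟩
    · have hqb : q ∈ binding φ := ⟨hq, by simpa [ballBoundary, hq, eq_comm] using hqX⟩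
      exact (hS ▸ hb hqb).1
    · by_contra hpO
      exact hlt.not_ge (hmin ⟨hp, hpO⟩)

theorem IsCollarRadius.mem_or_plateau_eq_zero (h : IsCollarRadius φ S δ) {p : ℂ × M}
    (hp : p ∈ ballBoundary φ) :
    S ∈ 𝓝[ballBoundary φ] p ∨ plateau δ =ᶠ[𝓝[ballBoundary φ] p] 0 := by
  refine (lt_or_ge (‖p.1‖ ^ 2) δ).imp (h.mem_nhdsWithin p hp) fun hδ => ?_
  have hcont : Continuous fun q : ℂ × M => ‖q.1‖ ^ 2 := by fun_prop
  have hlt : 2 * δ / 3 < ‖p.1‖ ^ 2 := by linarith [h.pos]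
  exact Filter.Eventually.filter_mono nhdsWithin_le_nhds
    ((hcont.continuousAt.eventually_const_lt hlt).mono fun q => plateau_eq_zero h.pos)

end CollarRadius

section CollarPullback

/-- The function `u` on `M'`, pulled back to a collar of `X` by a map `F` which multiplies `t` by
`r`, divided by `r` so that `(t, collarPullback)` and `(t', u)` define the same ray, and cut off. -/
def collarPullback {M M' V : Type*} [SMul ℝ V] (δ : ℝ) (r : ℂ × M → ℝ) (F : ℂ × M → ℂ × M')
    (u : M' → V) (p : ℂ × M) : V :=
  plateau δ p • (r p)⁻¹ • u (F p).2

theorem smul_collarPullback {M M' V : Type*} [AddCommGroup V] [Module ℝ V] {δ : ℝ}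
    {r : ℂ × M → ℝ} {F : ℂ × M → ℂ × M'} {p : ℂ × M} (u : M' → V) (hδ : 0 < δ)
    (hp : ‖p.1‖ ^ 2 < δ / 3) (hr : r p ≠ 0) : r p • collarPullback δ r F u p = u (F p).2 := by
  rw [collarPullback, plateau_eq_one hδ hp, one_smul, smul_inv_smul₀ hr]

variable {E : Type*} [NormedAddCommGroup E] [NormedSpace ℂ E]
  {M : Type*} [TopologicalSpace M] [ChartedSpace E M]
  {E' : Type*} [NormedAddCommGroup E'] [NormedSpace ℂ E']
  {M' : Type*} [TopologicalSpace M'] [ChartedSpace E' M']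
  {φ : M → ℝ} {φ' : M' → ℝ} {S : Set (ℂ × M)} {δ : ℝ} {r : ℂ × M → ℝ} {F : ℂ × M → ℂ × M'}

theorem IsScalingMapOn.collarPullback_rot {V : Type*} [AddCommGroup V] [Module ℝ V]
    (hF : IsScalingMapOn (E := E) (E' := E') φ' S r F) (hS : IsCollarRadius φ S δ) (u : M' → V)
    (c : Circle) {p : ℂ × M} (hp : p ∈ ballBoundary φ) :
    collarPullback δ r F u (rot c p) = collarPullback δ r F u p := by
  rw [collarPullback, plateau_rot]
  rcases hS.mem_or_plateau_eq_zero hp with hpS | h0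
  · have hpS := mem_of_mem_nhdsWithin hp hpS
    rw [hF.factor_rot c hpS, hF.equivariant c p hpS]
    rfl
  · rw [collarPullback, h0.self_of_nhdsWithin hp, Pi.zero_apply, zero_smul, zero_smul]

theorem IsScalingMapOn.isPrimitiveOn_collarPullback {ι : Type*} [Fintype ι]
    (hF : IsScalingMapOn (E := E) (E' := E') φ' S r F) (hS : IsCollarRadius φ S δ)
    {α : ℂ × M → ℂ × E → ℝ} {α' : ℂ × M' → ℂ × E' → ℝ} {u : ι → M' → ℂ}
    (hu : IsPrimitiveOn (totalModel E') (ballBoundary φ') (fun _ => univ) α' fun i q => u i q.2)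
    (hα : ∀ p ∈ S, ∃ L : ℂ × E →L[ℝ] ℂ × E', HasDerivOn F S p L ∧
      ∀ v, IsTangent φ p v → α' (F p) (L v) = r p ^ 2 * α p v) :
    IsPrimitiveOn (totalModel E) (ballBoundary φ) (fun p => {v | IsTangent φ p v})
      (fun p v => plateau δ p ^ 2 * α p v) fun i => collarPullback δ r F (u i) := by
  have hcomp : IsPrimitiveOn (totalModel E) S (fun p => {v | IsTangent φ p v})
      (fun p v => r p ^ 2 * α p v) fun i p => u i (F p).2 :=
    hu.comp hF.smooth hF.mapsTo fun p hp =>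
      let ⟨L, hL, hLα⟩ := hα p hp
      ⟨L, hL, fun v hv => ⟨mem_univ _, hLα v hv⟩⟩
  refine ((hcomp.smul (hF.smooth_factor.inv₀ fun p hp => (hF.factor_pos p hp).ne')).congr
    fun p hp v _ => ?_).smul_of_cutoff contMDiff_plateau.contMDiffOn
    fun p hp => hS.mem_or_plateau_eq_zero hp
  rw [inv_pow, inv_mul_cancel_left₀ (pow_ne_zero 2 (hF.factor_pos p hp).ne')]

theorem IsScalingMapOn.isPrimitiveOn_collarPullback_ofReal {κ : Type*} [Fintype κ]
    (hF : IsScalingMapOn (E := E) (E' := E') φ' S r F) (hS : IsCollarRadius φ S δ)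
    {g : κ → M' → ℝ} (hg : ∀ k, ContMDiff 𝓘(ℝ, E') 𝓘(ℝ, ℝ) ∞ (g k)) :
    IsPrimitiveOn (totalModel E) (ballBoundary φ) (fun p => {v | IsTangent φ p v})
      (fun _ _ => 0) fun k => collarPullback δ r F fun x => (g k x : ℂ) := by
  refine (hF.isPrimitiveOn_collarPullback hS (α := fun _ _ => 0)
    (.ofReal fun k => ((hg k).comp contMDiff_snd).contMDiffOn) fun p hp =>
      ⟨_, ((hF.smooth p hp).mdifferentiableWithinAt (by simp)).hasMFDerivWithinAt, fun v _ =>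
        (mul_zero _).symm⟩).congr fun p _ v _ => mul_zero _

end CollarPullback

section SphereMap

/-- The factor which scales `(t, v)` to the unit sphere. -/
def scaleFactor {M ι : Type*} [Fintype ι] (v : ι → ℂ × M → ℂ) (p : ℂ × M) : ℝ :=
  (√(‖p.1‖ ^ 2 + ∑ k, ‖v k p‖ ^ 2))⁻¹

/-- The map to the unit sphere whose value is on the ray of `(t, v)`. -/
def sphereMap {M : Type*} {N : ℕ} (v : Fin N → ℂ × M → ℂ) (p : ℂ × M) :
    ℂ × EuclideanSpace ℂ (Fin N) :=
  (scaleFactor v p • p.1, WithLp.toLp 2 fun k => scaleFactor v p • v k p)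

theorem sphereMap_eq_of_smul {M M' : Type*} {N : ℕ} {v : Fin N → ℂ × M → ℂ}
    {v' : Fin N → ℂ × M' → ℂ} {p : ℂ × M} {p' : ℂ × M'} {r : ℝ} (hr : 0 < r)
    (hfst : p'.1 = r • p.1) (hv : ∀ k, v' k p' = r • v k p) : sphereMap v p = sphereMap v' p' := by
  have hscale : scaleFactor v' p' * r = scaleFactor v p := by
    simp only [scaleFactor, hfst, hv, norm_smul, mul_pow]
    rw [← Finset.mul_sum, ← mul_add, Real.sqrt_mul (by positivity), Real.sqrt_sq (norm_nonneg r),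
      Real.norm_of_nonneg hr.le, mul_inv_rev, inv_mul_cancel_right₀ hr.ne']
  simp only [sphereMap, hfst, hv, smul_smul, hscale]

variable {E : Type*} [NormedAddCommGroup E] [NormedSpace ℂ E]
  {M : Type*} [TopologicalSpace M] [ChartedSpace E M] {φ : M → ℝ}

/-- The functions `v` on `X` are invariant, `∑ Im (v̄ dv) = ½ dφ ∘ J` on `X`, and the map
`(t, v)` followed by the projection to the sphere is an embedding: `v` determines the point of `M`
up to a common real factor, and the same is true of its derivative. -/
structure IsEmbeddingTuple {ι : Type*} [Fintype ι] (φ : M → ℝ) (v : ι → ℂ × M → ℂ) : Prop where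
  isPrimitiveOn : IsPrimitiveOn (totalModel E) (ballBoundary φ) (fun p => {w | IsTangent φ p w})
    (baseForm φ) v
  invariant : ∀ k, ∀ c : Circle, ∀ p ∈ ballBoundary φ, v k (rot c p) = v k p
  separates : ∀ p ∈ ballBoundary φ, ∀ q ∈ ballBoundary φ, ∀ s : ℝ, (∀ k, v k p = s • v k q) →
    s = 1 ∧ p.2 = q.2
  immersive : ∀ p ∈ ballBoundary φ, ∀ L : ι → ℂ × E →L[ℝ] ℂ,
    (∀ k, HasMFDerivWithinAt (totalModel E) 𝓘(ℝ, ℂ) (v k) (ballBoundary φ) p (L k)) →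
    ∀ w, IsTangent φ p w → ∀ s : ℝ, (∀ k, L k w = s • v k p) → s = 0 ∧ w.2 = 0

namespace IsEmbeddingTuple

section

variable {ι κ : Type*} [Fintype ι] [Fintype κ] {v : ι → ℂ × M → ℂ}

theorem pad {m : ℕ} (hv : IsEmbeddingTuple (E := E) φ v) (e : κ ≃ ι ⊕ Fin m) :
    IsEmbeddingTuple (E := E) φ fun k => Sum.elim v (fun _ _ => 0) (e k) where
  isPrimitiveOn := by
    have h := hv.isPrimitiveOn.sumElim (κ := Fin m) (.ofReal fun _ => contMDiffOn_const (c := 0))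
    simpa only [add_zero, Complex.ofReal_zero] using h.reindex e
  invariant k c p hp := by
    cases e k with
    | inl i => exact hv.invariant i c p hp
    | inr _ => rfl
  separates p hp q hq s h := hv.separates p hp q hq s fun i => by simpa using h (e.symm (.inl i))
  immersive p hp L hL w hw s h := by
    refine hv.immersive p hp (fun i => L (e.symm (.inl i))) (fun i => ?_) w hw s fun i => by
      simpa using h (e.symm (.inl i))
    have hLi := hL (e.symm (.inl i))
    rwa [e.apply_symm_apply] at hLi

theorem sum_norm_sq_pos (hv : IsEmbeddingTuple (E := E) φ v) {p : ℂ × M}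
    (hp : p ∈ ballBoundary φ) : 0 < ‖p.1‖ ^ 2 + ∑ k, ‖v k p‖ ^ 2 := by
  refine add_pos_of_nonneg_of_pos (sq_nonneg _)
    ((Finset.sum_nonneg fun k _ => sq_nonneg _).lt_of_ne' fun hsum => ?_)
  have h0 : ∀ k, v k p = 0 := fun k => by
    simpa using (Finset.sum_eq_zero_iff_of_nonneg fun k _ => sq_nonneg _).1 hsum k
      (Finset.mem_univ k)
  exact zero_ne_one (hv.separates p hp p hp 0 fun k => by simp [h0]).1

theorem scaleFactor_pos (hv : IsEmbeddingTuple (E := E) φ v) {p : ℂ × M}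
    (hp : p ∈ ballBoundary φ) : 0 < scaleFactor v p :=
  inv_pos.2 (Real.sqrt_pos.2 (hv.sum_norm_sq_pos hp))

theorem scaleFactor_rot (hv : IsEmbeddingTuple (E := E) φ v) (c : Circle) {p : ℂ × M}
    (hp : p ∈ ballBoundary φ) : scaleFactor v (rot c p) = scaleFactor v p := by
  simp only [scaleFactor, hv.invariant _ c p hp, norm_fst_rot]

theorem contMDiffOn_scaleFactor (hv : IsEmbeddingTuple (E := E) φ v) :
    ContMDiffOn (totalModel E) 𝓘(ℝ, ℝ) ∞ (scaleFactor v) (ballBoundary φ) := by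
  have hn : ContMDiff 𝓘(ℝ, ℂ) 𝓘(ℝ, ℝ) ∞ fun z : ℂ => ‖z‖ ^ 2 := (contDiff_norm_sq ℝ).contMDiff
  have hsum : ContMDiffOn (totalModel E) 𝓘(ℝ, ℝ) ∞
      (fun p : ℂ × M => ‖p.1‖ ^ 2 + ∑ k, ‖v k p‖ ^ 2) (ballBoundary φ) :=
    (hn.comp contMDiff_fst).contMDiffOn.add
      (contMDiffOn_finsetSum fun k _ => hn.comp_contMDiffOn (hv.isPrimitiveOn.contMDiffOn k))
  exact fun p hp => ContMDiffAt.comp_contMDiffWithinAt p (g := fun s : ℝ => (√s)⁻¹)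
    ((Real.contDiffAt_sqrt (hv.sum_norm_sq_pos hp).ne').inv
      (Real.sqrt_ne_zero'.2 (hv.sum_norm_sq_pos hp))).contMDiffAt (hsum p hp)

end

variable {N : ℕ} {v : Fin N → ℂ × M → ℂ}

theorem pullsBackCoordinate (hv : IsEmbeddingTuple (E := E) φ v) :
    PullsBackCoordinate (E := E) φ (sphereMap v) :=
  ⟨scaleFactor v, hv.contMDiffOn_scaleFactor, fun _ hp =>
    ⟨hv.scaleFactor_pos hp, Complex.real_smul⟩⟩

theorem mapsTo_sphereMap (hv : IsEmbeddingTuple (E := E) φ v) :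
    MapsTo (sphereMap v) (ballBoundary φ) (ballBoundary (sphereFn N)) := fun p hp => by
  rw [mem_ballBoundary_sphereFn]
  simp only [sphereMap, EuclideanSpace.norm_sq_eq, norm_smul, mul_pow]
  rw [← Finset.mul_sum, ← mul_add, Real.norm_eq_abs, sq_abs, scaleFactor, inv_pow,
    Real.sq_sqrt (hv.sum_norm_sq_pos hp).le, inv_mul_cancel₀ (hv.sum_norm_sq_pos hp).ne']

theorem isSmoothOn_sphereMap (hv : IsEmbeddingTuple (E := E) φ v) :
    IsSmoothOn (E := E) (E' := EuclideanSpace ℂ (Fin N)) (sphereMap v) (ballBoundary φ) :=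
  (hv.contMDiffOn_scaleFactor.smul contMDiffOn_fst).prodMk
    ((PiLp.continuousLinearEquiv 2 ℝ fun _ => ℂ).symm.contDiff.contMDiff.comp_contMDiffOn
      (contMDiffOn_pi_space.2 fun k =>
        hv.contMDiffOn_scaleFactor.smul (hv.isPrimitiveOn.contMDiffOn k)))

theorem injOn_sphereMap (hv : IsEmbeddingTuple (E := E) φ v) :
    InjOn (sphereMap v) (ballBoundary φ) := fun p hp q hq h => by
  have hdiv (a b : ℂ) (hab : scaleFactor v p • a = scaleFactor v q • b) :
      a = ((scaleFactor v p)⁻¹ * scaleFactor v q) • b := by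
    rw [mul_smul, ← hab, inv_smul_smul₀ (hv.scaleFactor_pos hp).ne']
  obtain ⟨hfst, hsnd⟩ := Prod.ext_iff.1 h
  obtain ⟨hs, hpq⟩ := hv.separates p hp q hq _ fun k =>
    hdiv _ _ (congrArg (fun z => z.ofLp k) hsnd)
  exact Prod.ext (by rw [hdiv _ _ hfst, hs, one_smul]) hpq

theorem sphereMap_rot (hv : IsEmbeddingTuple (E := E) φ v) (c : Circle) {p : ℂ × M}
    (hp : p ∈ ballBoundary φ) : sphereMap v (rot c p) = rot c (sphereMap v p) := by
  simp only [sphereMap, hv.scaleFactor_rot c hp, hv.invariant _ c p hp]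
  simp only [rot, mul_smul_comm]

theorem hasDerivOn_sphereMap {p : ℂ × M} {l : ℂ × E →L[ℝ] ℝ} {L : Fin N → ℂ × E →L[ℝ] ℂ}
    (hl : HasMFDerivWithinAt (totalModel E) 𝓘(ℝ, ℝ) (scaleFactor v) (ballBoundary φ) p l)
    (hL : ∀ k, HasMFDerivWithinAt (totalModel E) 𝓘(ℝ, ℂ) (v k) (ballBoundary φ) p (L k)) :
    HasDerivOn (E := E) (E' := EuclideanSpace ℂ (Fin N)) (sphereMap v) (ballBoundary φ) p
      ((scaleFactor v p • ContinuousLinearMap.fst ℝ ℂ E + l.smulRight p.1).prod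
        ((PiLp.continuousLinearEquiv 2 ℝ fun _ : Fin N => ℂ).symm.toContinuousLinearMap.comp
          (.pi fun k => scaleFactor v p • L k + l.smulRight (v k p)))) := by
  have hpi : HasMFDerivWithinAt (totalModel E) 𝓘(ℝ, Fin N → ℂ)
      (fun q k => scaleFactor v q • v k q) (ballBoundary φ) p
      (ContinuousLinearMap.pi fun k => scaleFactor v p • L k + l.smulRight (v k p)) :=
    ⟨continuousWithinAt_pi.2 fun k => hl.1.smul (hL k).1,
      hasFDerivWithinAt_pi.2 fun k => (hasMFDerivWithinAt_smul hl (hL k)).2⟩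
  exact (hasMFDerivWithinAt_smul (L := ContinuousLinearMap.fst ℝ ℂ E) hl
    (hasMFDerivWithinAt_fst _ _)).prodMk
    ((PiLp.continuousLinearEquiv 2 ℝ fun _ : Fin N => ℂ).symm.hasMFDerivAt.comp_hasMFDerivWithinAt
      p hpi)

theorem exists_hasDerivOn_sphereMap (hv : IsEmbeddingTuple (E := E) φ v) {p : ℂ × M}
    (hp : p ∈ ballBoundary φ) {L : Fin N → ℂ × E →L[ℝ] ℂ}
    (hL : ∀ k, HasMFDerivWithinAt (totalModel E) 𝓘(ℝ, ℂ) (v k) (ballBoundary φ) p (L k)) :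
    ∃ (K : ℂ × E →L[ℝ] ℂ × EuclideanSpace ℂ (Fin N)) (l : ℂ × E →L[ℝ] ℝ),
      HasDerivOn (E := E) (E' := EuclideanSpace ℂ (Fin N)) (sphereMap v) (ballBoundary φ) p K ∧
      ∀ w, (K w).1 = scaleFactor v p • w.1 + l w • p.1 ∧
        ∀ k, (K w).2 k = scaleFactor v p • L k w + l w • v k p :=
  ⟨_, _, hasDerivOn_sphereMap
    ((hv.contMDiffOn_scaleFactor p hp).mdifferentiableWithinAt (by simp)).hasMFDerivWithinAt hL,
    fun _ => ⟨rfl, fun _ => rfl⟩⟩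

theorem isImmersionOn_sphereMap (hv : IsEmbeddingTuple (E := E) φ v) :
    IsImmersionOn (E := E) (E' := EuclideanSpace ℂ (Fin N)) φ (sphereMap v) (ballBoundary φ) := by
  intro p hp
  obtain ⟨L, hL, -⟩ := hv.isPrimitiveOn.exists_deriv p hp
  obtain ⟨K, l, hK, hKL⟩ := hv.exists_hasDerivOn_sphereMap hp hL
  refine ⟨K, hK, fun w hw h0 => ?_⟩
  have hdiv (a b : ℂ) (hab : scaleFactor v p • a + l w • b = 0) :
      a = (-((scaleFactor v p)⁻¹ * l w)) • b := by
    rw [neg_smul, mul_smul, eq_neg_of_add_eq_zero_right hab, smul_neg,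
      inv_smul_smul₀ (hv.scaleFactor_pos hp).ne', neg_neg]
  obtain ⟨hfst, hsnd⟩ := hKL w
  obtain ⟨hs, hw2⟩ := hv.immersive p hp L hL w hw _ fun k =>
    hdiv _ _ ((hsnd k).symm.trans (by rw [h0]; rfl))
  refine Prod.ext ?_ hw2
  rw [hdiv _ _ (hfst.symm.trans (by rw [h0]; rfl)), hs, zero_smul]
  rfl

theorem isContactOn_sphereMap (hv : IsEmbeddingTuple (E := E) φ v) :
    IsContactOn (E := E) (E' := EuclideanSpace ℂ (Fin N)) φ (sphereFn N) (sphereMap v)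
      (ballBoundary φ) := by
  intro p hp
  obtain ⟨L, hL, hα⟩ := hv.isPrimitiveOn.exists_deriv p hp
  obtain ⟨K, l, hK, hKL⟩ := hv.exists_hasDerivOn_sphereMap hp hL
  refine ⟨K, hK, scaleFactor v p ^ 2, pow_pos (hv.scaleFactor_pos hp) 2, fun w hw => ?_⟩
  have hinner : (inner ℂ (sphereMap v p).2 (K w).2).im = scaleFactor v p ^ 2 * baseForm φ p w := by
    rw [← hα w hw, Finset.mul_sum, PiLp.inner_apply, Complex.im_sum]
    refine Finset.sum_congr rfl fun k _ => ?_
    rw [(hKL w).2 k, ← im_conj_smul_mul _ (l w), mul_comm]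
    rfl
  rw [contactForm_sphereFn, Complex.add_im, hinner, contactForm_eq_add_baseForm, (hKL w).1,
    mul_add (scaleFactor v p ^ 2), ← im_conj_smul_mul _ (l w)]
  rfl

theorem isContactEmbedding_sphereMap (hv : IsEmbeddingTuple (E := E) φ v) :
    IsContactEmbedding (E := E) φ (sphereMap v) where
  mapsTo := hv.mapsTo_sphereMap
  smooth := hv.isSmoothOn_sphereMap
  injective := hv.injOn_sphereMap
  immersion := hv.isImmersionOn_sphereMap
  contact := hv.isContactOn_sphereMap
  equivariant c _ hp := hv.sphereMap_rot c hp

end IsEmbeddingTuple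

theorem IsRegularDefining.deriv_ofReal_comp_snd [FiniteDimensional ℂ E] [IsManifold 𝓘(ℂ, E) ω M]
    (hφ : IsRegularDefining (E := E) φ) {p : ℂ × M} (hp : p ∈ ballBoundary φ) {g : M → ℝ}
    (hg : MDifferentiableAt 𝓘(ℝ, E) 𝓘(ℝ, ℝ) g p.2) {L : ℂ × E →L[ℝ] ℂ}
    (hL : HasMFDerivWithinAt (totalModel E) 𝓘(ℝ, ℂ) (fun q : ℂ × M => (g q.2 : ℂ))
      (ballBoundary φ) p L) {w : ℂ × E} (hw : IsTangent φ p w) : L w = (diff g p.2 w.2 : ℂ) := by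
  have hsnd := hg.hasMFDerivAt.comp p
    (hasMFDerivAt_snd (I := 𝓘(ℝ, ℂ)) (I' := 𝓘(ℝ, E)) p)
  exact hφ.isSubmanifold_ballBoundary.deriv_unique hp hL
    (Complex.ofRealCLM.hasMFDerivAt.comp_hasMFDerivWithinAt p
      (hsnd.hasMFDerivWithinAt (s := ballBoundary φ))) hw

theorem IsRegularDefining.isEmbeddingTuple [FiniteDimensional ℂ E] [IsManifold 𝓘(ℂ, E) ω M]
    {ι κ : Type*} [Fintype ι] {v : ι → ℂ × M → ℂ} {g : κ → M → ℝ}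
    (hφ : IsRegularDefining (E := E) φ)
    (hv : IsPrimitiveOn (totalModel E) (ballBoundary φ) (fun p => {w | IsTangent φ p w})
      (baseForm φ) v)
    (hinv : ∀ k, ∀ c : Circle, ∀ p ∈ ballBoundary φ, v k (rot c p) = v k p)
    (hg : IsEmbeddingFamily 𝓘(ℝ, E) {x | 0 ≤ φ x} g) (e : κ → ι)
    (hgv : ∀ k p, v (e k) p = (g k p.2 : ℂ)) : IsEmbeddingTuple (E := E) φ v where
  isPrimitiveOn := hv
  invariant := hinv
  separates p hp q hq s h := by
    have hgs : ∀ k, g k p.2 = s * g k q.2 := fun k => by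
      have hk := h (e k)
      rw [hgv, hgv, Complex.real_smul] at hk
      exact_mod_cast hk
    obtain ⟨k₀, hk₀⟩ := hg.exists_eq_one
    have hs : s = 1 := by simpa [hk₀] using (hgs k₀).symm
    exact ⟨hs, hg.injOn (nonneg_of_mem_ballBoundary hp) (nonneg_of_mem_ballBoundary hq)
      (funext fun k => (hgs k).trans (by rw [hs, one_mul]))⟩
  immersive p hp L hL w hw s h := by
    have hgs : ∀ k, diff (g k) p.2 w.2 = s * g k p.2 := fun k => by
      have hk := hφ.deriv_ofReal_comp_snd hp ((hg.contMDiff k).mdifferentiable (by simp) p.2)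
        ((funext (hgv k) : v (e k) = _) ▸ hL (e k)) hw
      rw [h (e k), hgv, Complex.real_smul] at hk
      exact_mod_cast hk.symm
    obtain ⟨k₀, hk₀⟩ := hg.exists_eq_one
    have hconst : diff (g k₀) p.2 w.2 = 0 := by
      rw [diff, show g k₀ = fun _ => 1 from funext hk₀, mfderiv_const]
      rfl
    have hs : s = 0 := by simpa [hk₀, hconst] using (hgs k₀).symm
    exact ⟨hs, hg.immersive p.2 (nonneg_of_mem_ballBoundary hp) w.2 fun k =>
      (hgs k).trans (by rw [hs, zero_mul])⟩

end SphereMap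

section Main

variable {M M' ι κ ι' κ' : Type*}

/-- The functions on `X` used to embed it: those of `M'` pulled back to the collar, completed by
functions of `M` which vanish near the binding or are real. -/
def sourceTuple (δ : ℝ) (r : ℂ × M → ℝ) (F : ℂ × M → ℂ × M') (u' : ι' → M' → ℂ)
    (g' : κ' → M' → ℝ) (u : ι → M → ℂ) (g : κ → M → ℝ) : ((ι' ⊕ κ') ⊕ ι) ⊕ κ → ℂ × M → ℂ :=
  Sum.elim (Sum.elim (Sum.elim (fun i => collarPullback δ r F (u' i))
    fun k => collarPullback δ r F fun x => (g' k x : ℂ)) fun i p => coplateau δ p • u i p.2)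
    fun k p => (g k p.2 : ℂ)

/-- The functions on `X'` which correspond to those of `sourceTuple`. -/
def targetTuple (ι : Type*) (δ : ℝ) (r : ℂ × M' → ℝ) (F : ℂ × M' → ℂ × M) (u' : ι' → M' → ℂ)
    (g' : κ' → M' → ℝ) (g : κ → M → ℝ) : ((ι' ⊕ κ') ⊕ ι) ⊕ κ → ℂ × M' → ℂ :=
  Sum.elim (Sum.elim (Sum.elim (fun i q => u' i q.2) fun k q => (g' k q.2 : ℂ)) fun _ _ => 0)
    fun k => collarPullback δ r F fun x => (g k x : ℂ)

theorem targetTuple_apply_eq_smul {δ δ' : ℝ} {r : ℂ × M → ℝ} {f : PartialEquiv (ℂ × M) (ℂ × M')}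
    (u' : ι' → M' → ℂ) (g' : κ' → M' → ℝ) (u : ι → M → ℂ) (g : κ → M → ℝ) (hδ : 0 < δ)
    (hδ' : 0 < δ') {p : ℂ × M} (hp : p ∈ f.source) (hr : r p ≠ 0) (hpδ : ‖p.1‖ ^ 2 < δ / 3)
    (hpδ' : ‖(f p).1‖ ^ 2 < δ' / 3) (k : ((ι' ⊕ κ') ⊕ ι) ⊕ κ) :
    targetTuple ι δ' (fun q => (r (f.symm q))⁻¹) f.symm u' g' g k (f p) =
      r p • sourceTuple δ r f u' g' u g k p := by
  rcases k with ((i | k) | i) | k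
  · exact (smul_collarPullback (u' i) hδ hpδ hr).symm
  · exact (smul_collarPullback (fun x => (g' k x : ℂ)) hδ hpδ hr).symm
  · simp [targetTuple, sourceTuple, coplateau_eq_zero hδ hpδ]
  · simp [targetTuple, sourceTuple, collarPullback, plateau_eq_one hδ' hpδ', f.left_inv hp]

variable {E : Type*} [NormedAddCommGroup E] [NormedSpace ℂ E] [TopologicalSpace M]
  [ChartedSpace E M] {E' : Type*} [NormedAddCommGroup E'] [NormedSpace ℂ E']
  [TopologicalSpace M'] [ChartedSpace E' M'] {φ : M → ℝ} {φ' : M' → ℝ}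

theorem IsCollarIso.eventually_nhdsSet_binding {f : PartialEquiv (ℂ × M) (ℂ × M')}
    (hf : IsCollarIso (E := E) (E' := E') φ φ' f) {ε ε' : ℝ} (hε : 0 < ε) (hε' : 0 < ε') :
    ∀ᶠ p in 𝓝ˢ (binding φ), p ∈ ballBoundary φ →
      p ∈ f.source ∧ ‖p.1‖ ^ 2 < ε ∧ ‖(f p).1‖ ^ 2 < ε' := by
  refine eventually_nhdsSet_iff_forall.2 fun p hp => eventually_nhdsWithin_iff.1 ?_
  have hps := hf.binding_subset hp
  have hsource : f.source ∈ 𝓝[ballBoundary φ] p := by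
    obtain ⟨O, hO, hs⟩ := hf.source_open
    rw [hs] at hps ⊢
    exact Filter.inter_mem (mem_nhdsWithin_of_mem_nhds (hO.mem_nhds hps.1)) self_mem_nhdsWithin
  have hfst : ContinuousWithinAt (fun q => ‖q.1‖ ^ 2) (ballBoundary φ) p :=
    Continuous.continuousWithinAt (by fun_prop)
  have hfst' : ContinuousWithinAt (fun q => ‖(f q).1‖ ^ 2) (ballBoundary φ) p :=
    (((hf.smooth p hps).continuousWithinAt.mono_of_mem_nhdsWithin hsource).fst.norm).pow 2
  have hfp : (f p).1 = 0 := (hf.image_binding ▸ mem_image_of_mem f hp : f p ∈ binding φ').1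
  filter_upwards [hsource, hfst.eventually_lt_const (by simpa [hp.1] using hε),
    hfst'.eventually_lt_const (by simpa [hfp] using hε')] with q hq hqε hqε'
  exact ⟨hq, hqε, hqε'⟩

section

variable [FiniteDimensional ℂ E] [IsManifold 𝓘(ℂ, E) ω M] [Fintype ι] [Fintype κ] [Fintype ι']
  [Fintype κ'] {S : Set (ℂ × M)} {δ : ℝ} {r : ℂ × M → ℝ} {F : ℂ × M → ℂ × M'}
  {u' : ι' → M' → ℂ} {g' : κ' → M' → ℝ} {u : ι → M → ℂ} {g : κ → M → ℝ}

theorem IsRegularDefining.isEmbeddingTuple_sourceTuple (hφ : IsRegularDefining (E := E) φ)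
    (hF : IsScalingMapOn (E := E) (E' := E') φ' S r F) (hS : IsCollarRadius φ S δ)
    (hα : ∀ p ∈ S, ∃ L : ℂ × E →L[ℝ] ℂ × E', HasDerivOn F S p L ∧
      ∀ v, IsTangent φ p v → baseForm φ' (F p) (L v) = r p ^ 2 * baseForm φ p v)
    (hu' : IsPrimitiveOn (totalModel E') (ballBoundary φ') (fun _ => univ) (baseForm φ')
      fun i q => u' i q.2)
    (hg' : ∀ k, ContMDiff 𝓘(ℝ, E') 𝓘(ℝ, ℝ) ∞ (g' k))
    (hu : IsPrimitiveOn (totalModel E) (ballBoundary φ) (fun _ => univ) (baseForm φ)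
      fun i p => u i p.2)
    (hg : IsEmbeddingFamily 𝓘(ℝ, E) {x | 0 ≤ φ x} g) :
    IsEmbeddingTuple (E := E) φ (sourceTuple δ r F u' g' u g) := by
  refine hφ.isEmbeddingTuple ?_ ?_ hg .inr fun k p => rfl
  · refine ((((hF.isPrimitiveOn_collarPullback hS hu' hα).sumElim
      (hF.isPrimitiveOn_collarPullback_ofReal hS hg')).sumElim
      ((hu.mono_tangent fun _ _ => subset_univ _).smul
        (contMDiff_coplateau (δ := δ)).contMDiffOn)).sumElim
      (.ofReal fun k => ((hg.contMDiff k).comp contMDiff_snd).contMDiffOn)).congr fun p _ v _ => ?_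
    rw [add_zero, add_zero, ← add_mul, plateau_sq_add_coplateau_sq, one_mul]
  · rintro (((i | k) | i) | k) c p hp
    · exact hF.collarPullback_rot hS (u' i) c hp
    · exact hF.collarPullback_rot hS (fun x => (g' k x : ℂ)) c hp
    · exact congrArg (· • u i p.2) (coplateau_rot c)
    · rfl

theorem IsRegularDefining.isEmbeddingTuple_targetTuple (hφ : IsRegularDefining (E := E) φ)
    (hF : IsScalingMapOn (E := E) (E' := E') φ' S r F) (hS : IsCollarRadius φ S δ)
    (hu : IsPrimitiveOn (totalModel E) (ballBoundary φ) (fun _ => univ) (baseForm φ)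
      fun i p => u i p.2)
    (hg : IsEmbeddingFamily 𝓘(ℝ, E) {x | 0 ≤ φ x} g)
    (hg' : ∀ k, ContMDiff 𝓘(ℝ, E') 𝓘(ℝ, ℝ) ∞ (g' k)) :
    IsEmbeddingTuple (E := E) φ (targetTuple ι' δ r F u g g') := by
  refine hφ.isEmbeddingTuple ?_ ?_ hg (.inl ∘ .inl ∘ .inr) fun k p => rfl
  · have hzero : IsPrimitiveOn (totalModel E) (ballBoundary φ) (fun p => {v | IsTangent φ p v})
        (fun _ _ => 0) fun (_ : ι') _ => ((0 : ℝ) : ℂ) := .ofReal fun _ => contMDiffOn_const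
    refine (((((hu.mono_tangent fun _ _ => subset_univ _).sumElim
      (.ofReal fun k => ((hg.contMDiff k).comp contMDiff_snd).contMDiffOn)).sumElim hzero).sumElim
      (hF.isPrimitiveOn_collarPullback_ofReal hS hg')).congr fun p _ v _ => ?_)
    rw [add_zero, add_zero, add_zero]
  · rintro (((i | k) | i) | k) c p hp
    · rfl
    · rfl
    · rfl
    · exact hF.collarPullback_rot hS (fun x => (g' k x : ℂ)) c hp

end

variable [FiniteDimensional ℂ E] [IsManifold 𝓘(ℂ, E) ω M] [T2Space M]
  [FiniteDimensional ℂ E'] [IsManifold 𝓘(ℂ, E') ω M'] [T2Space M']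

theorem IsCollarIso.exists_isEmbeddingTuple (hφ : IsRegularDefining (E := E) φ)
    (hφ' : IsRegularDefining (E := E') φ') {f : PartialEquiv (ℂ × M) (ℂ × M')}
    (hf : IsCollarIso (E := E) (E' := E') φ φ' f) :
    ∃ (J : Type) (_ : Fintype J) (v : J → ℂ × M → ℂ) (v' : J → ℂ × M' → ℂ) (r : ℂ × M → ℝ),
      IsEmbeddingTuple (E := E) φ v ∧ IsEmbeddingTuple (E := E') φ' v' ∧
      ∀ᶠ p in 𝓝ˢ (binding φ), p ∈ ballBoundary φ →
        p ∈ f.source ∧ 0 < r p ∧ (f p).1 = r p • p.1 ∧ ∀ k, v' k (f p) = r p • v k p := by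
  have : IsManifold 𝓘(ℝ, E) ∞ M := isManifold_real
  have : IsManifold 𝓘(ℝ, E') ∞ M' := isManifold_real
  have : FiniteDimensional ℝ E := FiniteDimensional.complexToReal E
  have : FiniteDimensional ℝ E' := FiniteDimensional.complexToReal E'
  obtain ⟨r, hr, hα⟩ := hf.exists_isScalingMapOn hφ hφ'
  obtain ⟨O, hO, hs⟩ := hf.source_open
  obtain ⟨O', hO', ht⟩ := hf.target_open
  have hb' : binding φ' ⊆ f.target :=
    hf.image_binding ▸ (image_mono hf.binding_subset).trans f.mapsTo.image_subset
  obtain ⟨δ, hδ⟩ := exists_isCollarRadius hφ.isCompact_ballBoundary hO hs hf.binding_subset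
  obtain ⟨δ', hδ'⟩ := exists_isCollarRadius hφ'.isCompact_ballBoundary hO' ht hb'
  obtain ⟨_, u, hu⟩ := hφ.exists_primitive_baseForm
  obtain ⟨_, u', hu'⟩ := hφ'.exists_primitive_baseForm
  obtain ⟨_, g, hg⟩ := exists_isEmbeddingFamily (I := 𝓘(ℝ, E)) hφ.isCompact_nonneg
  obtain ⟨_, g', hg'⟩ := exists_isEmbeddingFamily (I := 𝓘(ℝ, E')) hφ'.isCompact_nonneg
  refine ⟨_, inferInstance, _, _, r,
    hφ.isEmbeddingTuple_sourceTuple hr hδ hα hu' hg'.contMDiff hu hg,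
    hφ'.isEmbeddingTuple_targetTuple (hf.isScalingMapOn_symm hr) hδ' hu' hg' hg.contMDiff, ?_⟩
  filter_upwards [hf.eventually_nhdsSet_binding (div_pos hδ.pos three_pos)
    (div_pos hδ'.pos three_pos)] with p hp hpX
  obtain ⟨hps, hpδ, hpδ'⟩ := hp hpX
  have hrp := hr.factor_pos p hps
  exact ⟨hps, hrp, hr.fst_eq p hps,
    targetTuple_apply_eq_smul u' g' u g hδ.pos hδ'.pos hps hrp.ne' hpδ hpδ'⟩

end Main

end CircleBall

end

open CircleBall in
theorem mainTheorem6_general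
    {E : Type*} [NormedAddCommGroup E] [NormedSpace ℂ E] [FiniteDimensional ℂ E]
    {M : Type*} [TopologicalSpace M] [T2Space M] [ChartedSpace E M] [IsManifold 𝓘(ℂ, E) ω M]
    {E' : Type*} [NormedAddCommGroup E'] [NormedSpace ℂ E'] [FiniteDimensional ℂ E']
    {M' : Type*} [TopologicalSpace M'] [T2Space M'] [ChartedSpace E' M']
    [IsManifold 𝓘(ℂ, E') ω M']
    {φ : M → ℝ} (hφ : IsRegularDefining (E := E) φ)
    {φ' : M' → ℝ} (hφ' : IsRegularDefining (E := E') φ')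
    {f : PartialEquiv (ℂ × M) (ℂ × M')} (hf : IsCollarIso (E := E) (E' := E') φ φ' f) :
    ∃ N₀ : ℕ, ∀ N : ℕ, N₀ ≤ N →
      ∃ (U : ℂ × M → ℂ × EuclideanSpace ℂ (Fin N)) (U' : ℂ × M' → ℂ × EuclideanSpace ℂ (Fin N)),
        IsContactEmbedding (E := E) φ U ∧ IsContactEmbedding (E := E') φ' U' ∧
        (∃ W : Set (ℂ × M), IsOpen W ∧ binding φ ⊆ W ∧
          ∀ p ∈ W ∩ ballBoundary φ, p ∈ f.source ∧ U p = U' (f p)) ∧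
        PullsBackCoordinate (E := E) φ U ∧ PullsBackCoordinate (E := E') φ' U' := by
  obtain ⟨J, _, v, v', r, hv, hv', hray⟩ := hf.exists_isEmbeddingTuple hφ hφ'
  obtain ⟨W, hW, hbW, hWray⟩ := mem_nhdsSet_iff_exists.1 hray
  refine ⟨Fintype.card J, fun N hN => ?_⟩
  have e : Fin N ≃ J ⊕ Fin (N - Fintype.card J) :=
    Fintype.equivOfCardEq (by simp [Nat.add_sub_cancel' hN])
  have hV := hv.pad e
  have hV' := hv'.pad e
  refine ⟨_, _, hV.isContactEmbedding_sphereMap, hV'.isContactEmbedding_sphereMap,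
    ⟨W, hW, hbW, fun p ⟨hpW, hpX⟩ => ?_⟩, hV.pullsBackCoordinate, hV'.pullsBackCoordinate⟩
  obtain ⟨hps, hr, hfst, hvr⟩ := hWray hpW hpX
  refine ⟨hps, sphereMap_eq_of_smul hr hfst fun k => ?_⟩
  cases e k with
  | inl j => exact hvr j
  | inr _ => exact (smul_zero (r p)).symm

theorem mainTheorem6
    {E : Type*} [NormedAddCommGroup E] [NormedSpace ℂ E] [FiniteDimensional ℂ E]
    {M : Type*} [TopologicalSpace M] [T2Space M] [ChartedSpace E M] [IsManifold 𝓘(ℂ, E) ω M]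
    {E' : Type*} [NormedAddCommGroup E'] [NormedSpace ℂ E'] [FiniteDimensional ℂ E']
    {M' : Type*} [TopologicalSpace M'] [T2Space M'] [ChartedSpace E' M']
    [IsManifold 𝓘(ℂ, E') ω M']
    (φ : M → ℝ) (hφ : CircleBall.IsPseudoconvexDefining (E := E) φ)
    (φ' : M' → ℝ) (hφ' : CircleBall.IsPseudoconvexDefining (E := E') φ')
    (f : PartialEquiv (ℂ × M) (ℂ × M'))
    (hf : CircleBall.IsCollarIso (E := E) (E' := E') φ φ' f) :
    ∃ N₀ : ℕ, ∀ N : ℕ, N₀ ≤ N →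
      ∃ (U : ℂ × M → ℂ × EuclideanSpace ℂ (Fin N)) (U' : ℂ × M' → ℂ × EuclideanSpace ℂ (Fin N)),
        CircleBall.IsContactEmbedding (E := E) φ U ∧
        CircleBall.IsContactEmbedding (E := E') φ' U' ∧
        (∃ W : Set (ℂ × M), IsOpen W ∧ CircleBall.binding φ ⊆ W ∧
          ∀ p ∈ W ∩ CircleBall.ballBoundary φ, p ∈ f.source ∧ U p = U' (f p)) ∧
        CircleBall.PullsBackCoordinate (E := E) φ U ∧
        CircleBall.PullsBackCoordinate (E := E') φ' U' :=
  mainTheorem6_general hφ.isRegularDefining hφ'.isRegularDefining hf
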